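/- Let $S$ be a semitopological semigroup (a semigroup with a topology for which the multiplication is separately continuous), and let $X$ be an $S$-flow: a topological space with a separately continuous left action $S\times X\to X$, $s(tx)=(st)x$, in which the identity of $S$, if there is one, acts as the identity map. Say that a family of continuous maps $f_i\colon X\to Z_i$ *separates points and closed subsets* of $X$ if for every closed $A\subseteq X$ and every $x\in X\setminus A$ there is an $i$ with $f_i(x)\notin\overline{f_i(A)}$. Let $C(X)$ be the Banach space of bounded continuous functions $X\to\mathbb R$ with the supremum norm. A function $f\in C(X)$ is *weakly almost periodic* if $\{fs : s\in S\}$, where $(fs)(x)=f(sx)$, is relatively compact in the weak topology of $C(X)$. The flow $X$ is *weakly almost periodic* if its weakly almost periodic functions separate points and closed subsets of $X$. A *representation* of $(S,X)$ on a real Banach space $V$ is a pair $(h,\alpha)$, where $h\colon S\to\{T\in L(V,V):\|T\|\le 1\}$ satisfies $h(st)=h(t)h(s)$ and is continuous for the weak operator topology, and $\alpha\colon X\to B^*=\{\psi\in V^*:\|\psi\|\le1\}$ is weak$^*$ continuous with $\langle v,\alpha(sx)\rangle=\langle h(s)v,\alpha(x)\rangle$ for all $s\in S$, $x\in X$, $v\in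 V$. The flow $X$ is *Eberlein* if it has a representation on a reflexive Banach space for which $\alpha$ is a topological embedding into $(B^*,w^*)$. It is *REFL-approximable* if there is a family $(h_i,\alpha_i)$ of representations of $(S,X)$ on reflexive Banach spaces $V_i$ such that the maps $\alpha_i\colon X\to(B(V_i^*),w^*)$ separate points and closed subsets of $X$. Theorem. An $S$-flow $X$ is weakly almost periodic if and only if it is REFL-approximable. If $X$ is a $T_0$ space, this holds if and only if $X$ is a subdirect product of Eberlein $S$-flows, that is, there is an $S$-equivariant topological embedding of $X$ into a product of Eberlein $S$-flows. -/

import Mathlib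

open Topology
open scoped BoundedContinuousFunction

/-- The laws of a (left, semitopological) flow: the action `S × X → X` is separately continuous,
and an identity element of `S`, if there is one, acts as the identity map. Associativity
`s • (t • x) = (s * t) • x` is contained in `SemigroupAction S X`. -/
class IsSemitopFlow (S : Type*) (X : Type*) [Semigroup S] [TopologicalSpace S]
    [TopologicalSpace X] [SemigroupAction S X] : Prop where
  continuous_translation : ∀ s : S, Continuous fun x : X => s • x
  continuous_orbitMap : ∀ x : X, Continuous fun s : S => s • x
  identity_smul : ∀ e : S, (∀ s : S, e * s = s ∧ s * e = s) → ∀ x : X, e • x = x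

/-- A family of maps on `X` separates points and closed subsets: whenever `A` is closed and
`x ∉ A`, some member `f i` of the family satisfies `f i x ∉ closure (f i '' A)`. -/
def SeparatesPointsAndClosed {X ι : Type*} [TopologicalSpace X] {Z : ι → Type*}
    [∀ i, TopologicalSpace (Z i)] (f : ∀ i, X → Z i) : Prop :=
  ∀ (x : X) (A : Set X), IsClosed A → x ∉ A → ∃ i, f i x ∉ closure (f i '' A)

section WeaklyAlmostPeriodic

variable (S : Type*) {X : Type*} [Semigroup S] [TopologicalSpace S]
  [TopologicalSpace X] [SemigroupAction S X] [IsSemitopFlow S X]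

/-- The flowTranslate `(f s)(x) = f (s x)` of a bounded continuous real function. -/
def flowTranslate (f : X →ᵇ ℝ) (s : S) : X →ᵇ ℝ :=
  f.compContinuous ⟨fun x : X => s • x, IsSemitopFlow.continuous_translation s⟩

/-- `f ∈ C(X)` is weakly almost periodic: its orbit `f S` is relatively compact in the weak
topology of the Banach space `C(X)` of bounded continuous real functions. -/
def IsWapFunction (f : X →ᵇ ℝ) : Prop :=
  IsCompact (closure (toWeakSpace ℝ (X →ᵇ ℝ) '' Set.range (flowTranslate S f)))

variable (X) in
/-- The flow `X` is weakly almost periodic: the weakly almost periodic functions separate points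
and closed subsets of `X`. -/
def IsWapFlow : Prop :=
  SeparatesPointsAndClosed
    (fun (f : {f : X →ᵇ ℝ // IsWapFunction S f}) (x : X) => (f : X →ᵇ ℝ) x)

end WeaklyAlmostPeriodic

/-- A real normed space is reflexive: the canonical map into the bidual is onto. -/
def IsReflexiveSpace (V : Type*) [NormedAddCommGroup V] [NormedSpace ℝ V] : Prop :=
  Function.Surjective (NormedSpace.inclusionInDoubleDual ℝ V)

/-- A (non-expansive) representation of the flow `(S, X)` on the Banach space `V`: an
antihomomorphism `h` from `S` into the semigroup of operators of norm at most one on `V`,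
continuous for the weak operator topology, together with a weak-star continuous map `α` from `X`
into the closed unit ball of the dual of `V`, such that `α (s x) = (h s)* (α x)`. -/
structure FlowRepresentation (S X V : Type*) [Semigroup S] [TopologicalSpace S]
    [TopologicalSpace X] [SemigroupAction S X] [NormedAddCommGroup V] [NormedSpace ℝ V] where
  h : S → V →L[ℝ] V
  h_mul : ∀ s t : S, h (s * t) = (h t).comp (h s)
  h_norm_le : ∀ s : S, ‖h s‖ ≤ 1
  h_continuous : Continuous fun s : S => ContinuousLinearMapWOT.ofCLM (h s)
  α : X → WeakDual ℝ V
  α_norm_le : ∀ x : X, ‖WeakDual.toStrongDual (α x)‖ ≤ 1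
  α_continuous : Continuous α
  α_smul : ∀ (s : S) (x : X) (v : V), α (s • x) v = α x (h s v)

/-- The flow `(S, X)` is REFL-approximable: some system of representations on reflexive Banach
spaces separates points and closed subsets of `X`. Spaces and indices are taken in the
universe `w`. -/
def IsReflApproximable.{u, v, w} (S : Type v) (X : Type u) [Semigroup S] [TopologicalSpace S]
    [TopologicalSpace X] [SemigroupAction S X] : Prop :=
  ∃ (ι : Type w) (V : ι → Type w) (_ : ∀ i, NormedAddCommGroup (V i))
    (_ : ∀ i, NormedSpace ℝ (V i)) (ρ : ∀ i, FlowRepresentation S X (V i)),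
    (∀ i, CompleteSpace (V i)) ∧ (∀ i, IsReflexiveSpace (V i)) ∧
      SeparatesPointsAndClosed (fun i => (ρ i).α)

/-- The flow `(S, X)` is Eberlein: it has a representation on a reflexive Banach space that is
faithful, that is, `α` is a topological embedding for the weak-star topology. -/
def IsEberleinFlow.{u, v, w} (S : Type v) (X : Type u) [Semigroup S] [TopologicalSpace S]
    [TopologicalSpace X] [SemigroupAction S X] : Prop :=
  ∃ (V : Type w) (_ : NormedAddCommGroup V) (_ : NormedSpace ℝ V)
    (ρ : FlowRepresentation S X V),
    CompleteSpace V ∧ IsReflexiveSpace V ∧ IsEmbedding ρ.α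

/-- The flow `(S, X)` is a subdirect product of Eberlein flows: it embeds topologically and
equivariantly into a product (with coordinatewise action) of Eberlein `S`-flows. -/
def IsSubdirectProductOfEberlein.{u, v, w} (S : Type v) (X : Type u) [Semigroup S]
    [TopologicalSpace S] [TopologicalSpace X] [SemigroupAction S X] : Prop :=
  ∃ (ι : Type w) (Y : ι → Type w) (_ : ∀ i, TopologicalSpace (Y i))
    (_ : ∀ i, SemigroupAction S (Y i)) (Φ : X → ∀ i, Y i),
    (∀ i, IsSemitopFlow S (Y i)) ∧ (∀ i, IsEberleinFlow.{w, v, w} S (Y i)) ∧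
      IsEmbedding Φ ∧ ∀ (s : S) (x : X) (i : ι), Φ (s • x) i = s • Φ x i

universe u v w

/-! Both directions rest on Grothendieck's principle: a bounded, separately continuous function on a
product of compact spaces `P × B`, seen as a map `P → C(B, ℝ)`, is weakly continuous, so its image
is weakly compact (`continuous_dual_apply_of_pointwise`).

From representations to functions: for reflexive `V` the pairing of a ball of the bidual with the
unit ball of the dual is separately weak-star continuous. Translating a matrix coefficient only
moves its vector within a ball, so the orbit lies in a weakly compact set. The same holds for finite
sums of terms |coefficient - constant|, which separate a point from a closed set.

From functions to representations: the orbit of a weakly almost periodic `f` is weakly relatively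
compact, so Davis–Figiel–Johnson–Pełczyński interpolation gives a reflexive space that contains it
(`isReflexiveSpace_interpSpace`). Translations act there as contractions, point evaluations supply
`α`, and `f` is a matrix coefficient. Hence `f` factors continuously through `α`, which separates
whatever `f` separates.

For `T0` spaces a separating family is an embedding into the product of the images of the `α i`,
each an Eberlein flow. Conversely, finitely many coefficients from different factors separate a
point from a closed set in a subdirect product; this again yields weak almost periodicity. -/

/-! ### Pointwise and weak compactness in `C(B, ℝ)` -/

open Filter in
/-- A finite set of continuous functions on a compact space is, up to `ε`, determined by its values
on a finite set of points. -/
theorem exists_finset_dense_of_continuousMap {P B : Type*} [TopologicalSpace B] [CompactSpace B]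
    (G : P → C(B, ℝ)) (H : Finset P) {ε : ℝ} (hε : 0 < ε) :
    ∃ D : Finset B, ∀ b, ∃ d ∈ D, ∀ q ∈ H, |G q d - G q b| < ε := by
  obtain ⟨D, hD⟩ := CompactSpace.elim_nhds_subcover
    (fun d : B => {b | ∀ q ∈ H, |G q d - G q b| < ε}) (fun d => by
      refine (Filter.eventually_all_finset H).2 fun q _ => ?_
      have h : Continuous fun b => |G q d - G q b| := by fun_prop
      exact h.continuousAt.eventually_lt continuousAt_const (by simpa using hε))
  refine ⟨D, fun b => ?_⟩
  have : b ∈ ⋃ x ∈ D, {b | ∀ q ∈ H, |G q x - G q b| < ε} := by rw [hD]; trivial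
  simpa using this

open Filter in
/-- In a separately continuous family on a product of compact spaces, a function in the pointwise
closure of a subfamily is the pointwise limit of a sequence in it (here: the zero function). -/
theorem exists_seq_tendsto_zero_of_pointwise_closure {P B : Type*} [TopologicalSpace P]
    [CompactSpace P] [TopologicalSpace B] [CompactSpace B] (G : P → C(B, ℝ))
    (hG : ∀ b, Continuous fun p => G p b) (A : Set P)
    (hA : ∀ (D : Finset B) (ε : ℝ), 0 < ε → ∃ p ∈ A, ∀ d ∈ D, |G p d| < ε) :
    ∃ u : ℕ → P, (∀ k, u k ∈ A) ∧ ∀ b, Tendsto (fun k => G (u k) b) atTop (𝓝 0) := by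
  classical
  -- A stage carries a point of `A`, the earlier points, a finite subset of `B` that is dense up to
  -- `1 / (n + 1)` as seen by the earlier functions, and `n`. Each new function is small on all
  -- earlier finite sets.
  obtain ⟨f, hf, hr⟩ := exists_seq_of_forall_finset_exists
    (fun x : P × Finset P × Finset B × ℕ => x.1 ∈ A ∧
      ∀ b, ∃ d ∈ x.2.2.1, ∀ q ∈ x.2.1, |G q d - G q b| < 1 / ((x.2.2.2 : ℝ) + 1))
    (fun x y => x.1 ∈ y.2.1 ∧ x.2.2.2 < y.2.2.2 ∧
      ∀ d ∈ x.2.2.1, |G y.1 d| < 1 / ((y.2.2.2 : ℝ) + 1))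
    (fun s _ => by
      let n : ℕ := s.sup (fun x => x.2.2.2) + 1
      obtain ⟨p, hpA, hp⟩ := hA (s.biUnion fun x => x.2.2.1) (1 / ((n : ℝ) + 1)) (by positivity)
      obtain ⟨D, hD⟩ := exists_finset_dense_of_continuousMap G (s.image Prod.fst)
        (ε := 1 / ((n : ℝ) + 1)) (by positivity)
      refine ⟨(p, s.image Prod.fst, D, n), ⟨hpA, hD⟩, fun x hx => ⟨?_, ?_, ?_⟩⟩
      · exact Finset.mem_image_of_mem _ hx
      · exact Nat.lt_succ_of_le (Finset.le_sup (f := fun x : P × Finset P × Finset B × ℕ =>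
          x.2.2.2) hx)
      · exact fun d hd => hp d (Finset.mem_biUnion.2 ⟨x, hx, hd⟩))
  have hn : StrictMono fun k => (f k).2.2.2 := fun i j hij => (hr i j hij).2.1
  have hsmall : Tendsto (fun k => 1 / (((f k).2.2.2 : ℝ) + 1)) atTop (𝓝 0) :=
    tendsto_one_div_add_atTop_nhds_zero_nat.comp hn.tendsto_atTop
  refine ⟨fun k => (f k).1, fun k => (hf k).1, fun b => ?_⟩
  rw [tendsto_iff_ultrafilter]
  intro U hU
  set p : P := (U.map fun k => (f k).1).lim
  have hp : Tendsto (fun k => (f k).1) U (𝓝 p) := (U.map fun k => (f k).1).le_nhds_lim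
  have hGp : ∀ b', Tendsto (fun k => G (f k).1 b') U (𝓝 (G p b')) := fun b' =>
    ((hG b').tendsto p).comp hp
  -- Double limit argument: `d j` imitates `b` for the functions before stage `j`, so its limit `b'`
  -- is indistinguishable from `b` for every function of the sequence, hence for `G p`. But `G p`
  -- vanishes at each `d j`, so also at `b'`.
  choose d hdD hd using fun k => (hf k).2 b
  set b' : B := (U.map d).lim
  have hb' : Tendsto d U (𝓝 b') := (U.map d).le_nhds_lim
  have h1 : ∀ i, G (f i).1 b' = G (f i).1 b := fun i => by
    refine tendsto_nhds_unique (((G (f i).1).continuous.tendsto b').comp hb') ?_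
    refine Tendsto.mono_left ?_ hU
    rw [tendsto_iff_dist_tendsto_zero]
    refine squeeze_zero' (Eventually.of_forall fun _ => dist_nonneg) ?_ hsmall
    filter_upwards [eventually_gt_atTop i] with j hj
    exact (hd j _ (hr i j hj).1).le
  have h2 : G p b' = G p b := tendsto_nhds_unique (hGp b') (by simpa only [h1] using hGp b)
  have h3 : ∀ j, G p (d j) = 0 := fun j => by
    refine tendsto_nhds_unique (hGp (d j)) (Tendsto.mono_left ?_ hU)
    refine squeeze_zero_norm' ?_ hsmall
    filter_upwards [eventually_gt_atTop j] with k hk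
    exact ((hr j k hk).2.2 _ (hdD j)).le
  have h4 : G p b' = 0 := by
    refine tendsto_nhds_unique (((G p).continuous.tendsto b').comp hb') ?_
    simp [Function.comp_def, h3]
  have := hGp b
  rwa [← h2, h4] at this

open Filter MeasureTheory CompactlySupported in
/-- A bounded sequence of continuous functions on a compact Hausdorff space which tends to zero
pointwise has convex combinations of arbitrarily small norm. -/
theorem exists_mem_convexHull_norm_lt_of_tendsto_zero {B : Type*} [TopologicalSpace B]
    [CompactSpace B] [T2Space B] (g : ℕ → C(B, ℝ)) {C : ℝ} (hC : ∀ k, ‖g k‖ ≤ C)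
    (hg : ∀ b, Tendsto (fun k => g k b) atTop (𝓝 0)) {ε : ℝ} (hε : 0 < ε) :
    ∃ x ∈ convexHull ℝ (Set.range g), ‖x‖ < ε := by
  by_contra! hcon
  -- `s` contains every nonpositive function, which forces the separating functional to be positive,
  -- hence a measure; no signed measures are needed. `t` is built from absolute values so that it
  -- contains each `|g k|`.
  let s : Set C(B, ℝ) := {f | ∀ b, f b < ε}
  let t : Set C(B, ℝ) := {y | ∃ x ∈ convexHull ℝ (Set.range g), ∀ b, |x b| ≤ y b}
  have hs_open : IsOpen s := by
    have : s = {f : C(B, ℝ) | Set.MapsTo f Set.univ (Set.Iio ε)} := by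
      ext f; simp [s, Set.MapsTo]
    rw [this]
    exact ContinuousMap.isOpen_setOfPred_mapsTo isCompact_univ isOpen_Iio
  have hs : Convex ℝ s := by
    intro x hx y hy a b ha hb hab c
    have h := (convex_Iio ε) (hx c) (hy c) ha hb hab
    simpa using h
  have ht : Convex ℝ t := by
    rintro y ⟨x, hx, hxy⟩ y' ⟨x', hx', hxy'⟩ a b ha hb hab
    refine ⟨a • x + b • x', (convex_convexHull ℝ _) hx hx' ha hb hab, fun c => ?_⟩
    calc |(a • x + b • x') c| ≤ |a * x c| + |b * x' c| := by
          simpa using abs_add_le (a * x c) (b * x' c)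
      _ = a * |x c| + b * |x' c| := by rw [abs_mul, abs_mul, abs_of_nonneg ha, abs_of_nonneg hb]
      _ ≤ a * y c + b * y' c := by gcongr; exacts [hxy c, hxy' c]
      _ = (a • y + b • y') c := by simp
  have hst : Disjoint s t := by
    rw [Set.disjoint_left]
    rintro y hy ⟨x, hx, hxy⟩
    refine (hcon x hx).not_gt ((ContinuousMap.norm_lt_iff _ hε).2 fun b => ?_)
    exact (hxy b).trans_lt (hy b)
  obtain ⟨Λ, u, hu1, hu2⟩ := geometric_hahn_banach_open hs hs_open ht hst
  have hu : 0 < u := by simpa using hu1 0 (fun _ => by simpa using hε)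
  have hpos : ∀ f : C(B, ℝ), 0 ≤ f → 0 ≤ Λ f := fun f hf => by
    by_contra! hneg
    obtain ⟨n, hn⟩ := exists_nat_gt (u / (-Λ f))
    have h1 := hu1 (-((n : ℝ) • f)) (fun b => by
      have : 0 ≤ (n : ℝ) * f b := mul_nonneg n.cast_nonneg (hf b)
      simp only [ContinuousMap.neg_apply, ContinuousMap.smul_apply, smul_eq_mul]
      linarith)
    rw [map_neg, map_smul, smul_eq_mul] at h1
    rw [div_lt_iff₀ (by linarith)] at hn
    linarith
  let _ : MeasurableSpace B := borel B
  have : BorelSpace B := ⟨rfl⟩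
  let Λ' : C_c(B, ℝ) →ₚ[ℝ] ℝ :=
  { toFun := fun f => Λ f.toContinuousMap
    map_add' := fun f f' => Λ.map_add f.toContinuousMap f'.toContinuousMap
    map_smul' := fun c f => Λ.map_smul c f.toContinuousMap
    monotone' := fun f f' hff' => by
      have := hpos (f'.toContinuousMap - f.toContinuousMap) (fun b => by
        simpa using hff' b)
      rw [map_sub] at this
      linarith }
  let μ := RealRMK.rieszMeasure Λ'
  have hint : ∀ f : C(B, ℝ), ∫ b, f b ∂μ = Λ f := fun f =>
    RealRMK.integral_rieszMeasure Λ' (CompactlySupportedContinuousMap.continuousMapEquiv f)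
  have hlim : Tendsto (fun k => ∫ b, |g k b| ∂μ) atTop (𝓝 (∫ _, (0 : ℝ) ∂μ)) := by
    refine tendsto_integral_of_dominated_convergence (fun _ => C) (fun k => ?_)
      (integrable_const C) (fun k => ?_) ?_
    · exact (continuous_abs.comp (g k).continuous).aestronglyMeasurable
    · exact Eventually.of_forall fun b => by
        simpa using ((g k).norm_coe_le_norm b).trans (hC k)
    · exact Eventually.of_forall fun b => by simpa using (hg b).abs
  rw [integral_zero] at hlim
  -- The integrals of `|g k|` tend to zero by dominated convergence, yet are at least `u > 0` since
  -- `|g k|` is in `t`.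
  refine hu.not_ge (ge_of_tendsto' hlim fun k => ?_)
  have h1 := hint |g k|
  simp only [ContinuousMap.abs_apply] at h1
  rw [h1]
  exact hu2 _ ⟨g k, subset_convexHull ℝ _ ⟨k, rfl⟩, fun b => by simp⟩

/-- In a bounded separately continuous family on a product of compact spaces, if zero is in the
pointwise closure of a subfamily, then it is in the norm closure of its convex hull. -/
theorem exists_mem_convexHull_norm_lt_of_pointwise_closure {P B : Type*} [TopologicalSpace P]
    [CompactSpace P] [TopologicalSpace B] [CompactSpace B] [T2Space B] (G : P → C(B, ℝ))
    (hG : ∀ b, Continuous fun p => G p b) {C : ℝ} (hC : ∀ p, ‖G p‖ ≤ C) (A : Set P)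
    (hA : ∀ (D : Finset B) (ε : ℝ), 0 < ε → ∃ p ∈ A, ∀ d ∈ D, |G p d| < ε)
    {ε : ℝ} (hε : 0 < ε) :
    ∃ x ∈ convexHull ℝ (G '' A), ‖x‖ < ε := by
  obtain ⟨u, hu, hlim⟩ := exists_seq_tendsto_zero_of_pointwise_closure G hG A hA
  obtain ⟨x, hx, hxε⟩ := exists_mem_convexHull_norm_lt_of_tendsto_zero (fun k => G (u k))
    (fun k => hC _) hlim hε
  refine ⟨x, convexHull_mono ?_ hx, hxε⟩
  rintro _ ⟨k, rfl⟩
  exact ⟨u k, hu k, rfl⟩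

open Filter in
/-- Grothendieck: on a bounded separately continuous family on a product of compact spaces the
weak topology is the pointwise one. -/
theorem continuous_dual_apply_of_pointwise {P B : Type*} [TopologicalSpace P]
    [CompactSpace P] [TopologicalSpace B] [CompactSpace B] [T2Space B] (G : P → C(B, ℝ))
    (hG : ∀ b, Continuous fun p => G p b) {C : ℝ} (hC : ∀ p, ‖G p‖ ≤ C)
    (μ : StrongDual ℝ C(B, ℝ)) : Continuous fun p => μ (G p) := by
  -- The one-sided estimate is the useful one: `ε ≤ μ x` defines a convex set, so it survives
  -- passing to a convex combination of small norm, which is absurd. The other side comes from `-μ`.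
  have key : ∀ (μ : StrongDual ℝ C(B, ℝ)) (p₀ : P) (ε : ℝ), 0 < ε →
      ∀ᶠ p in 𝓝 p₀, μ (G p - G p₀) < ε := by
    intro μ p₀ ε hε
    by_contra hcon
    rw [not_eventually] at hcon
    obtain ⟨x, hx, hxε⟩ := exists_mem_convexHull_norm_lt_of_pointwise_closure
      (fun p => G p - G p₀) (fun b => (hG b).sub continuous_const)
      (C := C + C) (fun p => (norm_sub_le _ _).trans (add_le_add (hC _) (hC _)))
      {p | ε ≤ μ (G p - G p₀)} (fun D δ hδ => by
        have h1 : ∀ᶠ p in 𝓝 p₀, ∀ d ∈ D, |(G p - G p₀) d| < δ := by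
          refine (Filter.eventually_all_finset D).2 fun d _ => ?_
          have h : Continuous fun p => |G p d - G p₀ d| := by
            have := hG d
            fun_prop
          exact h.continuousAt.eventually_lt continuousAt_const (by simpa using hδ)
        obtain ⟨p, hp1, hp2⟩ := (hcon.and_eventually h1).exists
        exact ⟨p, not_lt.1 hp1, hp2⟩) (ε := ε / (‖μ‖ + 1)) (by positivity)
    have hmem : x ∈ {x | ε ≤ μ x} := by
      refine convexHull_min ?_ (convex_halfSpace_ge μ.isLinear ε) hx
      rintro _ ⟨p, hp, rfl⟩
      exact hp
    have h2 : μ x ≤ ‖μ‖ * ‖x‖ := (le_abs_self _).trans (μ.le_opNorm x)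
    have h3 : ‖x‖ * (‖μ‖ + 1) < ε := by rwa [lt_div_iff₀ (by positivity)] at hxε
    have h4 : ε ≤ μ x := hmem
    nlinarith [norm_nonneg x]
  rw [continuous_iff_continuousAt]
  intro p₀
  rw [ContinuousAt, Metric.tendsto_nhds]
  intro ε hε
  filter_upwards [key μ p₀ ε hε, key (-μ) p₀ ε hε] with p h1 h2
  rw [Real.dist_eq, ← map_sub, abs_lt]
  constructor
  · have : (-μ) (G p - G p₀) = -(μ (G p - G p₀)) := rfl
    linarith
  · exact h1

/-! ### Matrix coefficients on reflexive spaces are weakly almost periodic -/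

/-- The closed ball of radius `R` of the dual of `V`, with the weak-star topology. -/
abbrev DualBall (V : Type*) [NormedAddCommGroup V] [NormedSpace ℝ V] (R : ℝ) : Type _ :=
  {ψ : WeakDual ℝ V // ‖WeakDual.toStrongDual ψ‖ ≤ R}

instance (V : Type*) [NormedAddCommGroup V] [NormedSpace ℝ V] (R : ℝ) :
    CompactSpace (DualBall V R) := by
  have h := WeakDual.isCompact_closedBall (𝕜 := ℝ) (E := V) 0 R
  rw [isCompact_iff_compactSpace] at h
  have heq : (WeakDual.toStrongDual ⁻¹' Metric.closedBall (0 : StrongDual ℝ V) R) =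
      {ψ : WeakDual ℝ V | ‖WeakDual.toStrongDual ψ‖ ≤ R} := by
    ext ψ
    simp
  rw [heq] at h
  exact h

/-- Precomposition with a continuous map into a compact space, as a bounded operator. -/
noncomputable def precompOfCompact {X B : Type*} [TopologicalSpace X] [TopologicalSpace B]
    [CompactSpace B] (a : C(X, B)) : C(B, ℝ) →L[ℝ] (X →ᵇ ℝ) :=
  LinearMap.mkContinuous
    { toFun := fun f => (BoundedContinuousFunction.mkOfCompact f).compContinuous a
      map_add' := fun _ _ => rfl
      map_smul' := fun _ _ => rfl } 1 fun f => by
    rw [one_mul]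
    exact (BoundedContinuousFunction.norm_le (norm_nonneg f)).2 fun x => f.norm_coe_le_norm (a x)

/-- The functions pulled back from a bounded separately continuous family on
a product of compact spaces form a weakly compact set. -/
theorem isCompact_range_toWeakSpace_precompOfCompact {X P B : Type*} [TopologicalSpace X]
    [TopologicalSpace P] [CompactSpace P] [TopologicalSpace B] [CompactSpace B] [T2Space B]
    (a : C(X, B)) (G : P → C(B, ℝ)) (hG : ∀ b, Continuous fun p => G p b) {C : ℝ}
    (hC : ∀ p, ‖G p‖ ≤ C) :
    IsCompact (Set.range fun p => toWeakSpace ℝ (X →ᵇ ℝ) (precompOfCompact a (G p))) :=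
  isCompact_range <| WeakBilin.continuous_of_continuous_eval _ fun μ =>
    continuous_dual_apply_of_pointwise G hG hC (μ.comp (precompOfCompact a))

section

variable {S X : Type*} [Semigroup S] [TopologicalSpace S] [TopologicalSpace X] [SemigroupAction S X]
  {κ : Type*} [Fintype κ] {V : κ → Type*} [∀ k, NormedAddCommGroup (V k)]
  [∀ k, NormedSpace ℝ (V k)]

/-- A sum of distances of matrix coefficients of representations on reflexive spaces from
constants is weakly almost periodic. -/
theorem exists_isWapFunction_sum_abs_sub [IsSemitopFlow S X]
    (hV : ∀ k, IsReflexiveSpace (V k)) (ρ : ∀ k, FlowRepresentation S X (V k)) (v : ∀ k, V k)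
    (c : κ → ℝ) :
    ∃ g : X →ᵇ ℝ, IsWapFunction S g ∧ ∀ y, g y = ∑ k, |(ρ k).α y (v k) - c k| := by
  let G : (∀ k, DualBall (StrongDual ℝ (V k)) ‖v k‖) → C(∀ k, DualBall (V k) 1, ℝ) := fun p =>
    ⟨fun b => ∑ k, |(p k).1 (WeakDual.toStrongDual (b k).1) - c k|, by
      refine continuous_finsetSum _ fun k _ => ?_
      -- Reflexivity enters here: an element of the bidual is evaluation at a vector, hence
      -- weak-star continuous on the dual.
      obtain ⟨u, hu⟩ := hV k (WeakDual.toStrongDual (p k).1)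
      have h : ∀ b : ∀ k, DualBall (V k) 1,
          (p k).1 (WeakDual.toStrongDual (b k).1) = (b k).1 u := fun b => by
        rw [← WeakDual.toStrongDual_apply (p k).1, ← hu]
        rfl
      simp only [h]
      have : Continuous fun b : ∀ k, DualBall (V k) 1 => (b k).1 u :=
        (WeakDual.eval_continuous u).comp (continuous_subtype_val.comp (continuous_apply k))
      fun_prop⟩
  have hG : ∀ b, Continuous fun p => G p b := fun b => by
    refine continuous_finsetSum _ fun k _ => ?_
    have : Continuous fun p : ∀ k, DualBall (StrongDual ℝ (V k)) ‖v k‖ => (p k).1 (WeakDual.toStrongDual (b k).1) :=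
      (WeakDual.eval_continuous _).comp (continuous_subtype_val.comp (continuous_apply k))
    fun_prop
  have hC : ∀ p, ‖G p‖ ≤ ∑ k, (‖v k‖ + |c k|) := fun p => by
    refine (ContinuousMap.norm_le _ (by positivity)).2 fun b => ?_
    have : G p b = ∑ k, |(p k).1 (WeakDual.toStrongDual (b k).1) - c k| := rfl
    rw [this, Real.norm_of_nonneg (by positivity)]
    refine Finset.sum_le_sum fun k _ => (abs_sub _ _).trans (add_le_add ?_ le_rfl)
    refine ((WeakDual.toStrongDual (p k).1).le_opNorm _).trans ?_
    exact (mul_le_mul (p k).2 (b k).2 (norm_nonneg _) (norm_nonneg _)).trans (mul_one _).le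
  let a : C(X, ∀ k, DualBall (V k) 1) :=
    ⟨fun x k => ⟨(ρ k).α x, (ρ k).α_norm_le x⟩,
      continuous_pi fun k => ((ρ k).α_continuous).subtype_mk _⟩
  let e : ∀ w : ∀ k, V k, (∀ k, ‖w k‖ ≤ ‖v k‖) → ∀ k, DualBall (StrongDual ℝ (V k)) ‖v k‖ := fun w hw k =>
    ⟨StrongDual.toWeakDual (NormedSpace.inclusionInDoubleDual ℝ (V k) (w k)),
      (NormedSpace.double_dual_bound ℝ (V k) (w k)).trans (hw k)⟩
  have he : ∀ w hw y, precompOfCompact a (G (e w hw)) y = ∑ k, |(ρ k).α y (w k) - c k| :=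
    fun _ _ _ => rfl
  refine ⟨precompOfCompact a (G (e v fun _ => le_rfl)), ?_, he v fun _ => le_rfl⟩
  refine (isCompact_range_toWeakSpace_precompOfCompact a G hG hC).closure_of_subset ?_
  rintro _ ⟨_, ⟨s, rfl⟩, rfl⟩
  -- The translate by `s` has parameter `h s (v k)`, which stays in the ball of radius `‖v k‖`.
  have hs : ∀ k, ‖(ρ k).h s (v k)‖ ≤ ‖v k‖ := fun k =>
    (((ρ k).h s).le_of_opNorm_le ((ρ k).h_norm_le s) (v k)).trans (one_mul _).le
  refine ⟨e _ hs, congrArg (toWeakSpace ℝ (X →ᵇ ℝ)) (BoundedContinuousFunction.ext fun y => ?_)⟩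
  rw [he _ hs]
  refine Eq.trans ?_ (he v (fun _ => le_rfl) (s • y)).symm
  simp only [(ρ _).α_smul]

end

/-- A flow is weakly almost periodic as soon as points and closed sets are separated by finite
families of matrix coefficients of representations on reflexive spaces. -/
theorem isWapFlow_of_reflexive_representations {S X ι : Type*} [Semigroup S] [TopologicalSpace S]
    [TopologicalSpace X] [SemigroupAction S X] [IsSemitopFlow S X] {V : ι → Type*}
    [∀ i, NormedAddCommGroup (V i)] [∀ i, NormedSpace ℝ (V i)]
    (hV : ∀ i, IsReflexiveSpace (V i)) (ρ : ∀ i, FlowRepresentation S X (V i))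
    (hsep : ∀ (x : X) (A : Set X), IsClosed A → x ∉ A → ∃ (J : Finset (Σ i, V i)) (ε : ℝ), 0 < ε ∧
      ∀ y ∈ A, ∃ j ∈ J, ε ≤ |(ρ j.1).α y j.2 - (ρ j.1).α x j.2|) :
    IsWapFlow S X := by
  intro x A hA hx
  obtain ⟨J, ε, hε, hJ⟩ := hsep x A hA hx
  -- Centring each coefficient at its value at `x` makes `g` vanish at `x` and be at least `ε` on
  -- `A`.
  obtain ⟨g, hg, hgy⟩ := exists_isWapFunction_sum_abs_sub (V := fun j : J => V j.1.1)
    (fun j => hV _) (fun j => ρ j.1.1) (fun j => j.1.2) (fun j => (ρ j.1.1).α x j.1.2)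
  refine ⟨⟨g, hg⟩, fun hmem => ?_⟩
  have hsub : closure (g '' A) ⊆ Set.Ici ε := by
    refine closure_minimal ?_ isClosed_Ici
    rintro _ ⟨y, hy, rfl⟩
    obtain ⟨j, hj, hjε⟩ := hJ y hy
    rw [Set.mem_Ici, hgy]
    exact hjε.trans (Finset.single_le_sum (f := fun j : J =>
      |(ρ j.1.1).α y j.1.2 - (ρ j.1.1).α x j.1.2|) (fun _ _ => abs_nonneg _)
      (Finset.mem_univ (⟨j, hj⟩ : J)))
  have h0 : g x = 0 := by rw [hgy]; simp
  have := hsub hmem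
  simp only [h0, Set.mem_Ici] at this
  linarith

/-! ### When a functional on `E*` comes from `E` -/

/-- Helly: a functional on `E*` at distance at least `δ` from `E` can be separated, within the ball
of radius `1 / δ` of `E*`, from any finite set of points of `E`. -/
theorem exists_dual_apply_gt_of_le_dist {E : Type*} [NormedAddCommGroup E] [NormedSpace ℝ E]
    (F : StrongDual ℝ (StrongDual ℝ E)) {δ : ℝ} (hδ : 0 < δ)
    (hF : ∀ x, δ ≤ ‖F - NormedSpace.inclusionInDoubleDual ℝ E x‖) (D : Finset E) {ε : ℝ}
    (hε : 0 < ε) : ∃ φ : StrongDual ℝ E, ‖φ‖ ≤ 1 / δ ∧ 1 / 2 < F φ ∧ ∀ d ∈ D, |φ d| < ε := by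
  classical
  let L : StrongDual ℝ E →ₗ[ℝ] (D → ℝ) × ℝ :=
    { toFun := fun φ => (fun d => φ d, F φ)
      map_add' := fun φ ψ => by ext <;> simp
      map_smul' := fun c φ => by ext <;> simp }
  let s : Set ((D → ℝ) × ℝ) := closure (L '' Metric.closedBall 0 (1 / δ))
  by_cases hs : ((0 : D → ℝ), (1 : ℝ)) ∈ s
  · obtain ⟨_, ⟨φ, hφ, rfl⟩, hd⟩ := Metric.mem_closure_iff.1 hs (min ε (1 / 2)) (by positivity)
    rw [lt_min_iff, Prod.dist_eq, max_lt_iff, max_lt_iff] at hd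
    refine ⟨φ, by simpa using hφ, ?_, fun d hdD => ?_⟩
    · have := hd.2.2
      rw [Real.dist_eq, abs_lt] at this
      have h1 := this.2
      change 1 - F φ < 1 / 2 at h1
      linarith
    · have := (dist_le_pi_dist _ _ (⟨d, hdD⟩ : D)).trans_lt hd.1.1
      rw [dist_comm, Real.dist_eq] at this
      simpa [L] using this
  · exfalso
    have hconv : Convex ℝ s := ((convex_closedBall _ _).linear_image L).closure
    obtain ⟨f, u, hu1, hu2⟩ := geometric_hahn_banach_closed_point hconv isClosed_closure hs
    -- On the image of `L` the separating functional reads `φ y + b * F φ`. Being below `u < b` on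
    -- the ball of radius `1 / δ`, it puts `F` within `δ * (u / b) < δ` of the vector `-(b⁻¹ • y)`.
    let b : ℝ := f (0, 1)
    let y : E := ∑ d : D, f (Pi.single d 1, 0) • (d : E)
    have hfL : ∀ φ, f (L φ) = φ y + b * F φ := by
      intro φ
      have h1 : L φ = ∑ d : D, φ d • ((Pi.single d 1, 0) : (D → ℝ) × ℝ) +
          F φ • ((0, 1) : (D → ℝ) × ℝ) := by
        ext e
        · simp [L, Prod.fst_sum, Finset.sum_apply, Pi.single_apply]
        · simp [L, Prod.snd_sum]
      rw [h1, map_add, map_sum]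
      simp only [map_smul, smul_eq_mul, y, b, map_sum]
      rw [mul_comm (F φ)]
      congr 1
      exact Finset.sum_congr rfl fun d _ => mul_comm _ _
    have hball : ∀ φ : StrongDual ℝ E, ‖φ‖ ≤ 1 / δ → φ y + b * F φ < u := fun φ hφ => by
      rw [← hfL]
      exact hu1 _ (subset_closure ⟨φ, by simpa using hφ, rfl⟩)
    have hu0 : 0 < u := by simpa using hball 0 (by simpa using hδ.le)
    have hb : 0 < b := hu0.trans hu2
    have hbound : ‖F - NormedSpace.inclusionInDoubleDual ℝ E (-(b⁻¹ • y))‖ ≤ δ * (u / b) := by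
      refine ContinuousLinearMap.opNorm_le_of_unit_norm (by positivity) fun ψ hψ => ?_
      have hval : (F - NormedSpace.inclusionInDoubleDual ℝ E (-(b⁻¹ • y))) ψ =
          b⁻¹ * (ψ y + b * F ψ) := by
        rw [sub_apply, NormedSpace.dual_def, map_neg, map_smul, smul_eq_mul]
        field_simp
        ring
      have h1 := hball ((1 / δ) • ψ) (by
        rw [norm_smul, hψ, mul_one, Real.norm_of_nonneg (by positivity)])
      have h2 := hball (-((1 / δ) • ψ)) (by
        rw [norm_neg, norm_smul, hψ, mul_one, Real.norm_of_nonneg (by positivity)])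
      simp only [neg_apply, smul_apply, smul_eq_mul,
        map_neg, map_smul] at h1 h2
      have h3 : |ψ y + b * F ψ| ≤ δ * u := by
        rw [abs_le]
        constructor
        · have : -(1 / δ) * (ψ y + b * F ψ) < u := by linarith
          have := mul_lt_mul_of_pos_left this hδ
          have e : δ * (-(1 / δ) * (ψ y + b * F ψ)) = -(ψ y + b * F ψ) := by field_simp
          linarith
        · have : (1 / δ) * (ψ y + b * F ψ) < u := by linarith
          have := mul_lt_mul_of_pos_left this hδ
          have e : δ * ((1 / δ) * (ψ y + b * F ψ)) = ψ y + b * F ψ := by field_simp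
          linarith
      rw [hval, Real.norm_eq_abs, abs_mul, abs_of_pos (inv_pos.2 hb)]
      calc b⁻¹ * |ψ y + b * F ψ| ≤ b⁻¹ * (δ * u) := by gcongr
        _ = δ * (u / b) := by field_simp
    have h1 := (hF _).trans hbound
    have h2 : u / b < 1 := (div_lt_one hb).2 hu2
    nlinarith

/-- A point outside the range of a linear isometry of a Banach space has positive distance to it. -/
theorem exists_pos_le_norm_sub_of_notMem_range {E W : Type*} [NormedAddCommGroup E]
    [NormedSpace ℝ E] [CompleteSpace E] [NormedAddCommGroup W] [NormedSpace ℝ W] (f : E →ₗᵢ[ℝ] W)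
    {y : W} (hy : ∀ x, f x ≠ y) : ∃ δ : ℝ, 0 < δ ∧ ∀ x, δ ≤ ‖y - f x‖ := by
  obtain ⟨δ, hδ, hball⟩ := Metric.isOpen_iff.1
    f.isometry.isClosedEmbedding.isClosed_range.isOpen_compl y (by simpa using hy)
  refine ⟨δ, hδ, fun x => ?_⟩
  by_contra! hlt
  refine hball (?_ : f x ∈ Metric.ball y δ) ⟨x, rfl⟩
  rwa [Metric.mem_ball, dist_comm, dist_eq_norm]

/-- A bound for a functional on a set also holds on its weak closure. -/
theorem abs_dual_apply_le_of_mem_weak_closure {E : Type*} [NormedAddCommGroup E] [NormedSpace ℝ E]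
    {K : Set E} {φ : StrongDual ℝ E} {a : ℝ} (h : ∀ w ∈ K, |φ w| ≤ a) (k : WeakSpace ℝ E)
    (hk : k ∈ closure (toWeakSpace ℝ E '' K)) : |φ ((toWeakSpace ℝ E).symm k)| ≤ a := by
  have hcl : IsClosed {k : WeakSpace ℝ E | |φ ((toWeakSpace ℝ E).symm k)| ≤ a} := by
    have : Continuous fun k : WeakSpace ℝ E => φ ((toWeakSpace ℝ E).symm k) :=
      WeakBilin.eval_continuous (topDualPairing ℝ E).flip φ
    exact isClosed_le this.abs continuous_const
  refine closure_minimal ?_ hcl hk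
  rintro _ ⟨w, hw, rfl⟩
  exact h w hw

/-- Let `K` be bounded and weakly relatively compact in the Banach space `E`. A functional on `E*`
dominated, for all `n`, by a multiple of `2 ^ n * sup_K |φ| + 2 ^ (-n) * ‖φ‖` is in `E`. -/
theorem mem_range_inclusionInDoubleDual_of_forall_le {E : Type*} [NormedAddCommGroup E]
    [NormedSpace ℝ E] [CompleteSpace E] {K : Set E} (hK : IsCompact (closure (toWeakSpace ℝ E '' K)))
    {R : ℝ} (hR : ∀ w ∈ K, ‖w‖ ≤ R) (hR0 : 0 ≤ R) (F : StrongDual ℝ (StrongDual ℝ E)) {c : ℝ}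
    (hc : 0 ≤ c)
    (hF : ∀ (n : ℕ) (φ : StrongDual ℝ E) (a : ℝ), 0 ≤ a → (∀ w ∈ K, |φ w| ≤ a) →
      F φ ≤ c * (2 ^ n * a + (1 / 2) ^ n * ‖φ‖)) :
    ∃ x, NormedSpace.inclusionInDoubleDual ℝ E x = F := by
  by_contra hcon
  obtain ⟨δ, hδ, hdist⟩ := exists_pos_le_norm_sub_of_notMem_range
    (NormedSpace.inclusionInDoubleDualLi ℝ (E := E)) (y := F) (fun x hx => hcon ⟨x, hx⟩)
  let B := closure (toWeakSpace ℝ E '' K)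
  have : CompactSpace B := isCompact_iff_compactSpace.1 hK
  let G : DualBall E (1 / δ) → C(B, ℝ) := fun φ =>
    ⟨fun k => φ.1 ((toWeakSpace ℝ E).symm k.1),
      (WeakBilin.eval_continuous (topDualPairing ℝ E).flip
        (WeakDual.toStrongDual φ.1)).comp continuous_subtype_val⟩
  have hG : ∀ b, Continuous fun φ => G φ b := fun b =>
    (WeakDual.eval_continuous _).comp continuous_subtype_val
  have hGb : ∀ φ, ‖G φ‖ ≤ 1 / δ * R := fun φ => by
    refine (ContinuousMap.norm_le _ (by positivity)).2 fun k => ?_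
    refine abs_dual_apply_le_of_mem_weak_closure (φ := WeakDual.toStrongDual φ.1)
      (fun w hw => ?_) k.1 k.2
    refine ((WeakDual.toStrongDual φ.1).le_opNorm w).trans ?_
    exact mul_le_mul φ.2 (hR w hw) (norm_nonneg _) (by positivity)
  -- First `n` makes the term with `‖φ‖ ≤ 1 / δ` at most `1 / 8`; then the bound on `K` is chosen so
  -- that the other term is at most `1 / 8`. This contradicts `1 / 2 < F φ`.
  obtain ⟨n, hn⟩ := exists_pow_lt_of_lt_one (show 0 < 1 / (8 * (c * (1 / δ) + 1)) by positivity)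
    (show (1 / 2 : ℝ) < 1 by norm_num)
  obtain ⟨x, hx, hxε⟩ := exists_mem_convexHull_norm_lt_of_pointwise_closure G hG hGb
    {φ | 1 / 2 < F (WeakDual.toStrongDual φ.1)} (fun D ε hε => by
      classical
      obtain ⟨φ, h1, h2, h3⟩ := exists_dual_apply_gt_of_le_dist F hδ hdist
        (D.image fun k => (toWeakSpace ℝ E).symm k.1) hε
      exact ⟨⟨StrongDual.toWeakDual φ, h1⟩, h2, fun d hd => h3 _ (Finset.mem_image_of_mem _ hd)⟩)
    (ε := 1 / (8 * (c * 2 ^ n + 1))) (by positivity)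
  -- Both inequalities are convex in `φ`, so the small convex combination still comes from a
  -- functional satisfying them.
  have hmem : x ∈ {x : C(B, ℝ) | ∃ φ : StrongDual ℝ E, ‖φ‖ ≤ 1 / δ ∧ 1 / 2 < F φ ∧
      ∀ k : B, x k = φ ((toWeakSpace ℝ E).symm k.1)} := by
    refine convexHull_min ?_ ?_ hx
    · rintro _ ⟨φ, hφ, rfl⟩
      exact ⟨WeakDual.toStrongDual φ.1, φ.2, hφ, fun _ => rfl⟩
    · rintro x ⟨φ, h1, h2, h3⟩ y ⟨ψ, h4, h5, h6⟩ a b ha hb hab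
      refine ⟨a • φ + b • ψ, ?_, ?_, fun k => ?_⟩
      · have := convex_closedBall (0 : StrongDual ℝ E) (1 / δ) (x := φ) (by simpa using h1)
          (y := ψ) (by simpa using h4) ha hb hab
        simpa using this
      · have := convex_Ioi (𝕜 := ℝ) (1 / 2 : ℝ) h2 h5 ha hb hab
        simpa using this
      · simp [h3, h6]
  obtain ⟨φ, h1, h2, h3⟩ := hmem
  have h4 := hF n φ (1 / (8 * (c * 2 ^ n + 1))) (by positivity) fun w hw => by
    have := (x.norm_coe_le_norm ⟨toWeakSpace ℝ E w, subset_closure ⟨w, hw, rfl⟩⟩).trans hxε.le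
    rwa [h3, Real.norm_eq_abs] at this
  have h5 : c * (1 / 2) ^ n * ‖φ‖ ≤ 1 / 8 := by
    have h6 : (1 / 2 : ℝ) ^ n * (8 * (c * (1 / δ) + 1)) < 1 := by
      rwa [lt_div_iff₀ (by positivity)] at hn
    have h7 : c * (1 / 2) ^ n * ‖φ‖ ≤ c * (1 / 2) ^ n * (1 / δ) := by gcongr
    have h8 : 0 < (1 / 2 : ℝ) ^ n := by positivity
    nlinarith
  have h6 : c * 2 ^ n * (1 / (8 * (c * 2 ^ n + 1))) ≤ 1 / 8 := by
    rw [mul_one_div, div_le_div_iff₀ (by positivity) (by positivity)]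
    nlinarith
  nlinarith

/-! ### Functionals on `ℓ²` sums -/

section LpTwo

variable {ι : Type*} {F : ι → Type*} [∀ i, NormedAddCommGroup (F i)]

theorem lp_two_sum_sq_norm_le (f : lp F 2) (s : Finset ι) : ∑ i ∈ s, ‖f i‖ ^ 2 ≤ ‖f‖ ^ 2 := by
  simpa using lp.sum_rpow_le_norm_rpow (p := 2) (by simp) f s

theorem sum_mul_norm_le_sqrt_mul_norm (a : ι → ℝ) (f : lp F 2) (s : Finset ι) :
    ∑ i ∈ s, a i * ‖f i‖ ≤ √(∑ i ∈ s, a i ^ 2) * ‖f‖ := by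
  refine (Real.sum_mul_le_sqrt_mul_sqrt s a fun i => ‖f i‖).trans ?_
  gcongr
  exact Real.sqrt_le_left (norm_nonneg _) |>.2 (lp_two_sum_sq_norm_le f s)

variable [∀ i, NormedSpace ℝ (F i)] [DecidableEq ι]

/-- Testing `Φ` on the sum of the `a i • x i`, with `a i` the value of `Φ` at the `i`-th vector,
gives `A ≤ ‖Φ‖ * √A` for the sum `A` of squares. -/
theorem lp_two_sum_sq_dual_single_le (Φ : StrongDual ℝ (lp F 2)) (x : ∀ i, F i)
    (hx : ∀ i, ‖x i‖ ≤ 1) (s : Finset ι) : ∑ i ∈ s, Φ (lp.single 2 i (x i)) ^ 2 ≤ ‖Φ‖ ^ 2 := by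
  set a : ι → ℝ := fun i => Φ (lp.single 2 i (x i))
  set A := ∑ i ∈ s, a i ^ 2 with hA
  have hA0 : 0 ≤ A := Finset.sum_nonneg fun _ _ => sq_nonneg _
  have h1 : Φ (∑ i ∈ s, lp.single 2 i (a i • x i)) = A := by
    simp [a, A, sq, lp.single_smul]
  have h2 : ‖∑ i ∈ s, lp.single 2 i (a i • x i)‖ ^ 2 ≤ A := by
    have := lp.norm_sum_single (p := 2) (by simp) (fun i => a i • x i) s
    simp only [ENNReal.toReal_ofNat, Real.rpow_ofNat] at this
    rw [this]
    refine Finset.sum_le_sum fun i _ => ?_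
    rw [norm_smul, mul_pow, Real.norm_eq_abs, sq_abs]
    exact mul_le_of_le_one_right (sq_nonneg _) (pow_le_one₀ (norm_nonneg _) (hx i))
  have h3 : A ≤ ‖Φ‖ * ‖∑ i ∈ s, lp.single 2 i (a i • x i)‖ :=
    h1 ▸ (le_abs_self _).trans (Φ.le_opNorm _)
  have h4 : A ^ 2 ≤ ‖Φ‖ ^ 2 * A := by
    calc A ^ 2 ≤ (‖Φ‖ * ‖∑ i ∈ s, lp.single 2 i (a i • x i)‖) ^ 2 := by gcongr
      _ = ‖Φ‖ ^ 2 * ‖∑ i ∈ s, lp.single 2 i (a i • x i)‖ ^ 2 := mul_pow _ _ _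
      _ ≤ _ := by gcongr
  rcases hA0.eq_or_lt with h | h
  · rw [← h]; positivity
  · nlinarith

open Filter in
/-- A functional on an `ℓ²` sum is, up to `ε` in norm, supported on finitely many summands. -/
theorem exists_finset_norm_dual_sub_sum_single_le (Φ : StrongDual ℝ (lp F 2)) {ε : ℝ}
    (hε : 0 < ε) : ∃ s : Finset ι, ∀ y : lp F 2,
      |Φ (y - ∑ i ∈ s, lp.single 2 i (y i))| ≤ ε * ‖y‖ := by
  -- `x i` attains at least half the norm of `Φ` on the `i`-th summand; this factor 2 is why the
  -- tail is taken below `(ε / 2) ^ 2`.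
  have hx : ∀ i, ∃ x : F i, ‖x‖ ≤ 1 ∧
      ∀ y : F i, |Φ (lp.single 2 i y)| ≤ 2 * |Φ (lp.single 2 i x)| * ‖y‖ := fun i => by
    let T : StrongDual ℝ (F i) := Φ.comp (lp.singleContinuousLinearMap ℝ F 2 i)
    rcases eq_or_ne ‖T‖ 0 with h0 | h0
    · refine ⟨0, by simp, fun y => ?_⟩
      have := T.le_opNorm y
      rw [h0, zero_mul] at this
      have h1 : |Φ (lp.single 2 i y)| ≤ 0 := this
      exact h1.trans (by positivity)
    · obtain ⟨x, hx1, hx2⟩ := T.exists_lt_apply_of_lt_opNorm (r := ‖T‖ / 2)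
        (by have := (norm_nonneg T).lt_of_ne' h0; linarith)
      refine ⟨x, hx1.le, fun y => (T.le_opNorm y).trans ?_⟩
      have : ‖T‖ / 2 < |Φ (lp.single 2 i x)| := hx2
      gcongr
      linarith
  choose x hx1 hx2 using hx
  have hsum : Summable fun i => Φ (lp.single 2 i (x i)) ^ 2 :=
    summable_of_sum_le (fun _ => sq_nonneg _) (lp_two_sum_sq_dual_single_le Φ x hx1)
  obtain ⟨s, hs⟩ := summable_iff_vanishing_norm.1 hsum ((ε / 2) ^ 2) (by positivity)
  refine ⟨s, fun y => ?_⟩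
  have hlim : Tendsto (fun t : Finset ι => |Φ (∑ i ∈ t, lp.single 2 i (y i)
      - ∑ i ∈ s, lp.single 2 i (y i))|) atTop
      (𝓝 |Φ (y - ∑ i ∈ s, lp.single 2 i (y i))|) :=
    ((Φ.continuous.tendsto _).comp ((lp.hasSum_single (by simp) y).sub_const _)).abs
  refine le_of_tendsto hlim ?_
  filter_upwards [eventually_ge_atTop s] with t ht
  rw [← Finset.sum_sdiff ht, add_sub_cancel_right, map_sum]
  have h1 : √(∑ i ∈ t \ s, |Φ (lp.single 2 i (x i))| ^ 2) ≤ ε / 2 := by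
    refine (Real.sqrt_le_left (by positivity)).2 ?_
    have := hs (t \ s) Finset.sdiff_disjoint
    simp only [sq_abs]
    exact (le_abs_self _).trans this.le
  calc |∑ i ∈ t \ s, Φ (lp.single 2 i (y i))|
      ≤ ∑ i ∈ t \ s, |Φ (lp.single 2 i (y i))| := Finset.abs_sum_le_sum_abs _ _
    _ ≤ ∑ i ∈ t \ s, 2 * (|Φ (lp.single 2 i (x i))| * ‖y i‖) :=
        Finset.sum_le_sum fun i _ => (hx2 i (y i)).trans (mul_assoc _ _ _).le
    _ = 2 * ∑ i ∈ t \ s, |Φ (lp.single 2 i (x i))| * ‖y i‖ := by rw [Finset.mul_sum]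
    _ ≤ 2 * (ε / 2 * ‖y‖) := by
        gcongr
        exact (sum_mul_norm_le_sqrt_mul_norm _ y _).trans (by gcongr)
    _ = ε * ‖y‖ := by ring

end LpTwo

/-! ### The Davis–Figiel–Johnson–Pełczyński space and its reflexivity -/

section Interpolation

variable {E : Type*} [NormedAddCommGroup E] [NormedSpace ℝ E] (K : Set E)

/-- The polar of (roughly) `2 ^ n • conv (±K) + 2 ^ (-n) • ball`. -/
def interpPolar (n : ℕ) : Set (StrongDual ℝ E) :=
  -- The first condition follows from the second unless `K` is empty.
  {φ | (1 / 2) ^ n * ‖φ‖ ≤ 1 ∧ ∀ w ∈ K, 2 ^ n * |φ w| + (1 / 2) ^ n * ‖φ‖ ≤ 1}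

variable {K} in
theorem norm_le_of_mem_interpPolar {n : ℕ} {φ : StrongDual ℝ E} (hφ : φ ∈ interpPolar K n) :
    ‖φ‖ ≤ 2 ^ n := by
  have h := hφ.1
  rw [one_div, inv_pow, inv_mul_le_iff₀ (by positivity), mul_one] at h
  exact h

/-- A vector of `E` as a bounded function on the polar set; the norm of this function is
the gauge of `2 ^ n • conv (±K) + 2 ^ (-n) • ball`. -/
noncomputable def interpEval (n : ℕ) : E →ₗ[ℝ] (interpPolar K n →ᵇ ℝ) where
  toFun x := BoundedContinuousFunction.ofNormedAddCommGroup (fun φ => φ.1 x)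
    ((ContinuousLinearMap.apply ℝ ℝ x).continuous.comp continuous_subtype_val) (2 ^ n * ‖x‖)
    fun φ => (φ.1.le_opNorm x).trans (by gcongr; exact norm_le_of_mem_interpPolar φ.2)
  map_add' x y := by ext φ; exact map_add φ.1 x y
  map_smul' c x := by ext φ; exact map_smul φ.1 c x

theorem interpEval_apply (n : ℕ) (x : E) (φ : interpPolar K n) : interpEval K n x φ = φ.1 x := rfl

theorem norm_interpEval_le (n : ℕ) (x : E) : ‖interpEval K n x‖ ≤ 2 ^ n * ‖x‖ :=
  BoundedContinuousFunction.norm_ofNormedAddCommGroup_le _ (by positivity)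
    fun φ => (φ.1.le_opNorm x).trans (by gcongr; exact norm_le_of_mem_interpPolar φ.2)

-- Divided by `2 ^ n * a + (1 / 2) ^ n * ‖φ‖`, the functional falls into the polar set. This
-- inequality is the source of the hypothesis of `mem_range_inclusionInDoubleDual_of_forall_le`.
variable {K} in
theorem abs_dual_apply_le_mul_norm_interpEval {n : ℕ} {φ : StrongDual ℝ E} {a : ℝ} (ha : 0 ≤ a)
    (h : ∀ w ∈ K, |φ w| ≤ a) (x : E) :
    |φ x| ≤ (2 ^ n * a + (1 / 2) ^ n * ‖φ‖) * ‖interpEval K n x‖ := by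
  set t := 2 ^ n * a + (1 / 2) ^ n * ‖φ‖ with ht
  have ht0 : 0 ≤ t := by positivity
  rcases eq_or_ne φ 0 with rfl | hφ
  · simpa using by positivity
  have htpos : 0 < t := by
    have : 0 < ‖φ‖ := norm_pos_iff.2 hφ
    positivity
  have hnorm : ‖t⁻¹ • φ‖ = t⁻¹ * ‖φ‖ := by
    rw [norm_smul, Real.norm_of_nonneg (by positivity)]
  have hmem : t⁻¹ • φ ∈ interpPolar K n := by
    refine ⟨?_, fun w hw => ?_⟩
    · rw [hnorm, mul_left_comm, inv_mul_le_iff₀ htpos, mul_one, ht]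
      exact le_add_of_nonneg_left (by positivity)
    · have h1 : |(t⁻¹ • φ) w| = t⁻¹ * |φ w| := by
        rw [smul_apply, smul_eq_mul, abs_mul, abs_of_pos (inv_pos.2 htpos)]
      rw [hnorm, h1, mul_left_comm, mul_left_comm _ t⁻¹, ← mul_add, inv_mul_le_iff₀ htpos, mul_one,
        ht]
      gcongr
      exact h w hw
  have h2 := (interpEval K n x).norm_coe_le_norm ⟨_, hmem⟩
  rw [interpEval_apply, smul_apply, smul_eq_mul, Real.norm_eq_abs, abs_mul,
    abs_of_pos (inv_pos.2 htpos), inv_mul_le_iff₀ htpos] at h2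
  exact h2

/-- The domain of the Davis–Figiel–Johnson–Pełczyński interpolation space. -/
def interpSubmodule : Submodule ℝ E where
  carrier := {x | Memℓp (fun n => interpEval K n x) 2}
  add_mem' {x y} hx hy := by
    have h : (fun n => interpEval K n (x + y)) =
        (fun n => interpEval K n x) + fun n => interpEval K n y :=
      funext fun n => map_add (interpEval K n) x y
    change Memℓp (fun n => interpEval K n (x + y)) 2
    rw [h]
    exact Memℓp.add hx hy
  zero_mem' := by
    have h : (fun n => interpEval K n (0 : E)) = 0 := funext fun n => map_zero (interpEval K n)
    change Memℓp (fun n => interpEval K n (0 : E)) 2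
    rw [h]
    exact zero_memℓp
  smul_mem' c x hx := by
    have h : (fun n => interpEval K n (c • x)) = c • fun n => interpEval K n x :=
      funext fun n => map_smul (interpEval K n) c x
    change Memℓp (fun n => interpEval K n (c • x)) 2
    rw [h]
    exact Memℓp.const_smul hx c

/-- The Davis–Figiel–Johnson–Pełczyński interpolation space of the set `K`. -/
def InterpSpace : Type _ := interpSubmodule K

noncomputable instance : AddCommGroup (InterpSpace K) :=
  inferInstanceAs (AddCommGroup (interpSubmodule K))

noncomputable instance : Module ℝ (InterpSpace K) :=
  inferInstanceAs (Module ℝ (interpSubmodule K))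

/-- The interpolation space inside the `ℓ²` sum of the intermediate renormings. -/
noncomputable def interpToLp :
    InterpSpace K →ₗ[ℝ] lp (fun n : ℕ => interpPolar K n →ᵇ ℝ) 2 where
  toFun x := ⟨fun n => interpEval K n x.1, x.2⟩
  map_add' x y := by
    ext n : 2
    exact map_add (interpEval K n) x.1 y.1
  map_smul' c x := by
    ext n : 2
    exact map_smul (interpEval K n) c x.1

theorem interpToLp_apply (x : InterpSpace K) (n : ℕ) : interpToLp K x n = interpEval K n x.1 := rfl

variable {K} in
theorem norm_le_mul_norm_interpEval_zero {R : ℝ} (hR0 : 0 ≤ R) (hR : ∀ w ∈ K, ‖w‖ ≤ R) (x : E) :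
    ‖x‖ ≤ (R + 1) * ‖interpEval K 0 x‖ := by
  refine NormedSpace.norm_le_dual_bound ℝ x (by positivity) fun φ => ?_
  have := abs_dual_apply_le_mul_norm_interpEval (K := K) (n := 0) (φ := φ) (a := ‖φ‖ * R)
    (by positivity) (fun w hw => (φ.le_opNorm w).trans (by gcongr; exact hR w hw)) x
  rw [Real.norm_eq_abs]
  refine this.trans (le_of_eq ?_)
  ring

variable [hK : Fact (Bornology.IsBounded K)]

theorem exists_norm_le_mul_norm_interpEval_zero :
    ∃ C : ℝ, 0 ≤ C ∧ ∀ x, ‖x‖ ≤ C * ‖interpEval K 0 x‖ := by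
  obtain ⟨R, hR0, hR⟩ := hK.out.exists_pos_norm_le
  exact ⟨R + 1, by positivity, norm_le_mul_norm_interpEval_zero hR0.le hR⟩

theorem interpToLp_injective : Function.Injective (interpToLp K) := by
  rw [injective_iff_map_eq_zero]
  intro x hx
  obtain ⟨C, -, hC⟩ := exists_norm_le_mul_norm_interpEval_zero K
  have h := hC x.1
  rw [← interpToLp_apply, hx] at h
  exact Subtype.ext (by simpa using h : x.1 = 0)

noncomputable instance : NormedAddCommGroup (InterpSpace K) :=
  NormedAddCommGroup.induced _ _ (interpToLp K) (interpToLp_injective K)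

noncomputable instance : NormedSpace ℝ (InterpSpace K) :=
  NormedSpace.induced ℝ _ _ (interpToLp K)

theorem norm_interpToLp (x : InterpSpace K) : ‖interpToLp K x‖ = ‖x‖ := rfl

theorem norm_interpEval_le_norm (x : InterpSpace K) (n : ℕ) : ‖interpEval K n x.1‖ ≤ ‖x‖ :=
  lp.norm_apply_le_norm (by simp) (interpToLp K x) n

/-- The inclusion of the interpolation space. -/
noncomputable def interpIncl : InterpSpace K →L[ℝ] E :=
  LinearMap.mkContinuousOfExistsBound (interpSubmodule K).subtype <| by
    obtain ⟨C, hC0, hC⟩ := exists_norm_le_mul_norm_interpEval_zero K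
    exact ⟨C, fun x => (hC x.1).trans (by gcongr; exact norm_interpEval_le_norm K x 0)⟩

/-- The functionals coming from `E` are dense in the dual of the interpolation space. -/
theorem exists_norm_sub_comp_interpIncl_le (φ : StrongDual ℝ (InterpSpace K)) {ε : ℝ}
    (hε : 0 < ε) : ∃ ψ : StrongDual ℝ E, ‖φ - ψ.comp (interpIncl K)‖ ≤ ε := by
  let T : InterpSpace K →ₗᵢ[ℝ] lp (fun n : ℕ => interpPolar K n →ᵇ ℝ) 2 :=
    ⟨interpToLp K, norm_interpToLp K⟩
  -- Hahn–Banach extends `φ` to the whole `ℓ²` sum. Truncated to finitely many coordinates it comes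
  -- from `E`, since each intermediate norm is dominated by a multiple of the norm of `E`.
  obtain ⟨Φ, hΦ, -⟩ := exists_extension_norm_eq T.range
    (φ.comp T.equivRange.symm.toContinuousLinearEquiv.toContinuousLinearMap)
  have hΦ' : ∀ x, Φ (interpToLp K x) = φ x := fun x => by
    have := hΦ (T.equivRange x)
    simp only [ContinuousLinearMap.comp_apply] at this
    refine this.trans (congrArg φ ?_)
    exact T.equivRange.symm_apply_apply x
  obtain ⟨s, hs⟩ := exists_finset_norm_dual_sub_sum_single_le Φ hε
  let e : ∀ n, E →L[ℝ] (interpPolar K n →ᵇ ℝ) := fun n =>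
    (interpEval K n).mkContinuous (2 ^ n) (norm_interpEval_le K n)
  let ψ : StrongDual ℝ E := ∑ n ∈ s,
    (Φ.comp (lp.singleContinuousLinearMap ℝ (fun n : ℕ => interpPolar K n →ᵇ ℝ) 2 n)).comp (e n)
  refine ⟨ψ, ContinuousLinearMap.opNorm_le_bound _ hε.le fun x => ?_⟩
  have h1 : (φ - ψ.comp (interpIncl K)) x = Φ (interpToLp K x - ∑ n ∈ s,
      lp.single 2 n (interpToLp K x n)) := by
    rw [map_sub, hΦ', map_sum]
    simp only [sub_apply, ψ, ContinuousLinearMap.comp_apply, sum_apply]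
    rfl
  rw [h1]
  exact hs _

theorem norm_comp_interpIncl_le {n : ℕ} {φ : StrongDual ℝ E} {a : ℝ} (ha : 0 ≤ a)
    (h : ∀ w ∈ K, |φ w| ≤ a) :
    ‖φ.comp (interpIncl K)‖ ≤ 2 ^ n * a + (1 / 2) ^ n * ‖φ‖ := by
  refine ContinuousLinearMap.opNorm_le_bound _ (by positivity) fun x => ?_
  refine (abs_dual_apply_le_mul_norm_interpEval (n := n) ha h x.1).trans ?_
  gcongr
  exact norm_interpEval_le_norm K x n

theorem norm_sum_comp_interpIncl_le (s : Finset ℕ) (φ : ∀ n, interpPolar K n) (a : ℕ → ℝ) :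
    ‖(∑ n ∈ s, a n • (φ n).1).comp (interpIncl K)‖ ≤ √(∑ n ∈ s, a n ^ 2) := by
  refine ContinuousLinearMap.opNorm_le_bound _ (by positivity) fun x => ?_
  have h1 : ((∑ n ∈ s, a n • (φ n).1).comp (interpIncl K)) x =
      ∑ n ∈ s, a n * (interpToLp K x n) (φ n) := by
    simp only [ContinuousLinearMap.comp_apply, sum_apply, smul_apply, smul_eq_mul]
    rfl
  rw [h1, ← norm_interpToLp]
  calc ‖∑ n ∈ s, a n * (interpToLp K x n) (φ n)‖
      ≤ ∑ n ∈ s, ‖a n * (interpToLp K x n) (φ n)‖ := norm_sum_le _ _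
    _ ≤ ∑ n ∈ s, |a n| * ‖interpToLp K x n‖ := by
        refine Finset.sum_le_sum fun n _ => ?_
        rw [norm_mul, Real.norm_eq_abs]
        gcongr
        exact BoundedContinuousFunction.norm_coe_le_norm _ _
    _ ≤ √(∑ n ∈ s, |a n| ^ 2) * ‖interpToLp K x‖ := sum_mul_norm_le_sqrt_mul_norm _ _ _
    _ = _ := by simp only [sq_abs]

/-- A vector of `E` representing a functional on the dual of the interpolation space belongs
to the interpolation space. -/
theorem mem_interpSubmodule_of_forall_apply_eq (Ψ : StrongDual ℝ (StrongDual ℝ (InterpSpace K)))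
    {x : E} (hx : ∀ φ : StrongDual ℝ E, φ x = Ψ (φ.comp (interpIncl K))) :
    x ∈ interpSubmodule K := by
  -- Almost norming functionals `φ n` reduce the claim to bounding `A`, the sum of the `φ n x ^ 2`.
  -- Applying `Ψ` to the combination with coefficients `φ n x` gives `A ≤ ‖Ψ‖ * √A`.
  have hφ : ∀ n, ∃ φ : interpPolar K n, ‖interpEval K n x‖ ≤ 2 * |φ.1 x| := fun n => by
    by_contra! hcon
    have h0 : 0 < ‖interpEval K n x‖ := by
      have := hcon ⟨0, by simp [interpPolar]⟩
      simpa using this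
    have : ‖interpEval K n x‖ ≤ ‖interpEval K n x‖ / 2 :=
      (BoundedContinuousFunction.norm_le (by positivity)).2 fun φ => by
        have := hcon φ
        rw [interpEval_apply, Real.norm_eq_abs]
        linarith
    linarith
  choose φ hφ using hφ
  refine memℓp_gen' (C := 4 * ‖Ψ‖ ^ 2) fun s => ?_
  simp only [ENNReal.toReal_ofNat, Real.rpow_ofNat]
  set A := ∑ n ∈ s, (φ n).1 x ^ 2 with hA
  have hA0 : 0 ≤ A := Finset.sum_nonneg fun _ _ => sq_nonneg _
  have h1 : A = Ψ ((∑ n ∈ s, (φ n).1 x • (φ n).1).comp (interpIncl K)) := by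
    rw [← hx]
    simp [hA, sum_apply, sq]
  have h2 : A ≤ ‖Ψ‖ * √A := by
    conv_lhs => rw [h1]
    refine (le_abs_self _).trans ((Ψ.le_opNorm _).trans ?_)
    gcongr
    exact norm_sum_comp_interpIncl_le K s φ fun n => (φ n).1 x
  have h3 : A ≤ ‖Ψ‖ ^ 2 := by
    have h4 := Real.sq_sqrt hA0
    rcases (Real.sqrt_nonneg A).eq_or_lt with h | h
    · nlinarith [sq_nonneg ‖Ψ‖]
    · have : √A ≤ ‖Ψ‖ := by nlinarith
      rw [← h4]
      gcongr
  calc ∑ n ∈ s, ‖interpEval K n x‖ ^ 2 ≤ ∑ n ∈ s, 4 * (φ n).1 x ^ 2 := by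
        refine Finset.sum_le_sum fun n _ => ?_
        calc ‖interpEval K n x‖ ^ 2 ≤ (2 * |(φ n).1 x|) ^ 2 := by gcongr; exact hφ n
          _ = 4 * (φ n).1 x ^ 2 := by rw [mul_pow, sq_abs]; norm_num
    _ = 4 * A := by rw [Finset.mul_sum]
    _ ≤ 4 * ‖Ψ‖ ^ 2 := by gcongr

/-- Davis–Figiel–Johnson–Pełczyński: the interpolation space of a weakly relatively compact set is
reflexive. -/
theorem isReflexiveSpace_interpSpace [CompleteSpace E]
    (hcomp : IsCompact (closure (toWeakSpace ℝ E '' K))) : IsReflexiveSpace (InterpSpace K) := by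
  intro Ψ
  obtain ⟨R, hR0, hR⟩ := hK.out.exists_pos_norm_le
  let J : StrongDual ℝ E →L[ℝ] StrongDual ℝ (InterpSpace K) :=
    ContinuousLinearMap.precomp ℝ (interpIncl K)
  -- Pulled back to `E*`, `Ψ` is given by some `x` in `E`; `x` lies in the interpolation space, and
  -- it represents `Ψ` because functionals from `E` are dense in the dual.
  obtain ⟨x, hx⟩ := mem_range_inclusionInDoubleDual_of_forall_le hcomp hR hR0.le (Ψ.comp J)
    (norm_nonneg Ψ) fun n φ a ha h => by
      refine (le_abs_self _).trans ((Ψ.le_opNorm _).trans ?_)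
      gcongr
      exact norm_comp_interpIncl_le K ha h
  have hx' : ∀ φ : StrongDual ℝ E, φ x = Ψ (φ.comp (interpIncl K)) := fun φ =>
    DFunLike.congr_fun hx φ
  let v : InterpSpace K := ⟨x, mem_interpSubmodule_of_forall_apply_eq K Ψ hx'⟩
  refine ⟨v, ContinuousLinearMap.ext fun φ => ?_⟩
  rw [NormedSpace.dual_def, ← sub_eq_zero, ← norm_le_zero_iff]
  refine le_of_forall_pos_le_add fun ε hε => ?_
  obtain ⟨ψ, hψ⟩ := exists_norm_sub_comp_interpIncl_le K φ (ε := ε / (‖v‖ + ‖Ψ‖ + 1))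
    (by positivity)
  set χ := φ - ψ.comp (interpIncl K) with hχ
  have h1 : φ v - Ψ φ = χ v - Ψ χ := by
    have : (ψ.comp (interpIncl K)) v = ψ x := rfl
    rw [hχ, map_sub, sub_apply, this, hx' ψ]
    ring
  have hV : 0 ≤ ‖v‖ + ‖Ψ‖ := by positivity
  calc ‖φ v - Ψ φ‖ ≤ ‖χ v‖ + ‖Ψ χ‖ := h1 ▸ norm_sub_le _ _
    _ ≤ ‖χ‖ * ‖v‖ + ‖Ψ‖ * ‖χ‖ := add_le_add (χ.le_opNorm v) (Ψ.le_opNorm χ)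
    _ = ‖χ‖ * (‖v‖ + ‖Ψ‖) := by ring
    _ ≤ ε / (‖v‖ + ‖Ψ‖ + 1) * (‖v‖ + ‖Ψ‖ + 1) :=
        mul_le_mul hψ (by linarith) hV (by positivity)
    _ = 0 + ε := by field_simp; ring

end Interpolation

/-- A reflexive space is complete. -/
theorem IsReflexiveSpace.completeSpace {V : Type*} [NormedAddCommGroup V] [NormedSpace ℝ V]
    (hV : IsReflexiveSpace V) : CompleteSpace V :=
  (LinearIsometryEquiv.ofSurjective (NormedSpace.inclusionInDoubleDualLi ℝ (E := V))
    hV).toIsometryEquiv.completeSpace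

/-! ### Operators on the interpolation space -/

section InterpMap

variable {E : Type*} [NormedAddCommGroup E] [NormedSpace ℝ E] (K : Set E)

-- Precomposition with `T` keeps the polar set invariant, so `T` contracts every intermediate norm.
variable {K} in
theorem norm_interpEval_apply_le {T : E →L[ℝ] E} (hT : ‖T‖ ≤ 1) (hTK : Set.MapsTo T K K) (n : ℕ)
    (x : E) : ‖interpEval K n (T x)‖ ≤ ‖interpEval K n x‖ := by
  refine (BoundedContinuousFunction.norm_le (norm_nonneg _)).2 fun φ => ?_
  have hnorm : ‖φ.1.comp T‖ ≤ ‖φ.1‖ :=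
    (φ.1.opNorm_comp_le T).trans (mul_le_of_le_one_right (norm_nonneg _) hT)
  have hmem : φ.1.comp T ∈ interpPolar K n := by
    refine ⟨le_trans (by gcongr) φ.2.1, fun w hw => le_trans ?_ (φ.2.2 _ (hTK hw))⟩
    simp only [ContinuousLinearMap.comp_apply]
    gcongr
  exact (interpEval K n x).norm_coe_le_norm ⟨_, hmem⟩

variable {K} in
/-- The elements of `K` belong to the interpolation space. -/
theorem mem_interpSubmodule_of_mem {w : E} (hw : w ∈ K) : w ∈ interpSubmodule K := by
  have h : ∀ n, ‖interpEval K n w‖ ≤ (1 / 2) ^ n := fun n => by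
    refine (BoundedContinuousFunction.norm_le (by positivity)).2 fun φ => ?_
    have h1 := φ.2.2 w hw
    have h2 : 0 ≤ (1 / 2) ^ n * ‖φ.1‖ := by positivity
    rw [interpEval_apply, Real.norm_eq_abs, one_div, inv_pow, ← one_div, le_div_iff₀ (by positivity)]
    linarith
  refine memℓp_gen (Summable.of_nonneg_of_le (fun n => by positivity) (fun n => ?_)
    (summable_geometric_of_lt_one (r := (1 / 2 : ℝ)) (by norm_num) (by norm_num)))
  simp only [ENNReal.toReal_ofNat, Real.rpow_ofNat]
  calc ‖interpEval K n w‖ ^ 2 ≤ ((1 / 2) ^ n) ^ 2 := by gcongr; exact h n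
    _ ≤ (1 / 2) ^ n := pow_le_of_le_one (by positivity) (pow_le_one₀ (by norm_num) (by norm_num))
        two_ne_zero

variable [hK : Fact (Bornology.IsBounded K)]

/-- A contraction mapping `K` into itself acts on the interpolation space. -/
noncomputable def interpMap (T : E →L[ℝ] E) (hT : ‖T‖ ≤ 1) (hTK : Set.MapsTo T K K) :
    InterpSpace K →L[ℝ] InterpSpace K :=
  LinearMap.mkContinuous
    { toFun := fun x => ⟨T x.1, Memℓp.mono' x.2 fun n => norm_interpEval_apply_le hT hTK n x.1⟩
      map_add' := fun x y => Subtype.ext (map_add T x.1 y.1)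
      map_smul' := fun c x => Subtype.ext (map_smul T c x.1) } 1 fun x => by
    rw [one_mul, ← norm_interpToLp, ← norm_interpToLp]
    exact lp.norm_mono (by simp) fun n => norm_interpEval_apply_le hT hTK n x.1

theorem norm_interpMap_le (T : E →L[ℝ] E) (hT : ‖T‖ ≤ 1) (hTK : Set.MapsTo T K K) :
    ‖interpMap K T hT hTK‖ ≤ 1 :=
  LinearMap.mkContinuous_norm_le _ zero_le_one _

end InterpMap

/-! ### Weak operator continuity and transport of representations -/

/-- Hahn–Banach for a closed subspace and a point outside of it. -/
theorem exists_dual_ne_zero_of_notMem_closed {V : Type*} [NormedAddCommGroup V] [NormedSpace ℝ V]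
    (M : Submodule ℝ V) (hM : IsClosed (M : Set V)) {x : V} (hx : x ∉ M) :
    ∃ f : StrongDual ℝ V, f x ≠ 0 ∧ ∀ y ∈ M, f y = 0 := by
  obtain ⟨f, u, hf, hu⟩ := geometric_hahn_banach_closed_point M.convex hM hx
  have hu0 : 0 < u := by simpa using hf 0 M.zero_mem
  refine ⟨f, (hu0.trans hu).ne', fun y hy => ?_⟩
  by_contra hne
  have := hf ((u / f y) • y) (M.smul_mem _ hy)
  rw [map_smul, smul_eq_mul, div_mul_cancel₀ _ hne] at this
  exact lt_irrefl _ this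

/-- On a reflexive space, a bounded family of operators is continuous for the weak operator
topology as soon as this can be tested on a separating family of functionals. -/
theorem continuous_ofCLM_of_separating {S V : Type*} [TopologicalSpace S] [NormedAddCommGroup V]
    [NormedSpace ℝ V] (hV : IsReflexiveSpace V) (h : S → V →L[ℝ] V) (hn : ∀ s, ‖h s‖ ≤ 1)
    (A : Set (StrongDual ℝ V)) (hsep : ∀ v, (∀ φ ∈ A, φ v = 0) → v = 0)
    (hA : ∀ φ ∈ A, ∀ v, Continuous fun s => φ (h s v)) :
    Continuous fun s => ContinuousLinearMapWOT.ofCLM (h s) := by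
  let M : Submodule ℝ (StrongDual ℝ V) :=
    { carrier := {φ | ∀ v, Continuous fun s => φ (h s v)}
      add_mem' := fun hφ hψ v => (hφ v).add (hψ v)
      zero_mem' := fun v => continuous_const
      smul_mem' := fun c φ hφ v => (hφ v).const_smul c }
  have hM : IsClosed (M : Set (StrongDual ℝ V)) := by
    refine isClosed_of_closure_subset fun φ hφ v => ?_
    refine continuous_of_uniform_approx_of_continuous fun u hu => ?_
    obtain ⟨ε, hε, hu⟩ := Metric.mem_uniformity_dist.1 hu
    obtain ⟨ψ, hψ, hd⟩ := Metric.mem_closure_iff.1 hφ (ε / (‖v‖ + 1)) (by positivity)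
    refine ⟨fun s => ψ (h s v), hψ v, fun s => hu ?_⟩
    rw [dist_eq_norm] at hd
    rw [dist_eq_norm, ← sub_apply]
    have h1 : ‖h s v‖ ≤ ‖v‖ := ((h s).le_of_opNorm_le (hn s) v).trans (one_mul _).le
    calc ‖(φ - ψ) (h s v)‖ ≤ ‖φ - ψ‖ * ‖h s v‖ := (φ - ψ).le_opNorm _
      _ ≤ ‖φ - ψ‖ * (‖v‖ + 1) := by gcongr; linarith
      _ < ε := by rwa [lt_div_iff₀ (by positivity)] at hd
  -- A functional on the dual that vanishes on `M` is, by reflexivity, a vector killed by all of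
  -- `A`, hence zero; so the closed subspace `M` is everything.
  have htop : ∀ φ, φ ∈ M := fun φ => by
    by_contra hφ
    obtain ⟨Ψ, hΨ, hΨM⟩ := exists_dual_ne_zero_of_notMem_closed M hM hφ
    obtain ⟨v, rfl⟩ := hV Ψ
    have : v = 0 := hsep v fun φ hφA => hΨM φ (hA φ hφA)
    exact hΨ (by rw [this]; simp)
  exact ContinuousLinearMapWOT.continuous_of_dual_apply_continuous fun v φ => htop φ v

section Transfer

variable {V W : Type*} [NormedAddCommGroup V] [NormedSpace ℝ V] [NormedAddCommGroup W]
  [NormedSpace ℝ W]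

theorem IsReflexiveSpace.of_linearIsometryEquiv (hV : IsReflexiveSpace V) (e : V ≃ₗᵢ[ℝ] W) :
    IsReflexiveSpace W := by
  intro Ψ
  obtain ⟨v, hv⟩ := hV (Ψ.comp (ContinuousLinearMap.precomp ℝ
    e.symm.toContinuousLinearEquiv.toContinuousLinearMap))
  refine ⟨e v, ContinuousLinearMap.ext fun φ => ?_⟩
  have := DFunLike.congr_fun hv (φ.comp e.toContinuousLinearEquiv.toContinuousLinearMap)
  refine this.trans (congrArg Ψ (ContinuousLinearMap.ext fun w => ?_))
  exact congrArg φ (e.apply_symm_apply w)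

/-- Transport of a representation along an isometric isomorphism. -/
noncomputable def FlowRepresentation.congr {S X : Type*} [Semigroup S] [TopologicalSpace S]
    [TopologicalSpace X] [SemigroupAction S X] (ρ : FlowRepresentation S X V) (e : V ≃ₗᵢ[ℝ] W) :
    FlowRepresentation S X W where
  h s := e.toContinuousLinearEquiv.toContinuousLinearMap.comp
    ((ρ.h s).comp e.symm.toContinuousLinearEquiv.toContinuousLinearMap)
  h_mul s t := by
    ext w
    simp [ρ.h_mul]
  h_norm_le s := by
    refine ContinuousLinearMap.opNorm_le_bound _ zero_le_one fun w => ?_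
    have := (ρ.h s).le_of_opNorm_le (ρ.h_norm_le s) (e.symm w)
    simpa using this
  h_continuous := ContinuousLinearMapWOT.continuous_of_dual_apply_continuous fun w φ =>
    (ContinuousLinearMapWOT.continuous_dual_apply (e.symm w)
      (φ.comp e.toContinuousLinearEquiv.toContinuousLinearMap)).comp ρ.h_continuous
  α x := StrongDual.toWeakDual ((WeakDual.toStrongDual (ρ.α x)).comp
    e.symm.toContinuousLinearEquiv.toContinuousLinearMap)
  α_norm_le x := by
    refine ContinuousLinearMap.opNorm_le_bound _ zero_le_one fun w => ?_
    have := (WeakDual.toStrongDual (ρ.α x)).le_of_opNorm_le (ρ.α_norm_le x) (e.symm w)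
    rw [e.symm.norm_map] at this
    exact this
  α_continuous := WeakDual.continuous_of_continuous_eval fun w =>
    (WeakDual.eval_continuous (e.symm w)).comp ρ.α_continuous
  α_smul s x w := by
    have := ρ.α_smul s x (e.symm w)
    refine this.trans (congrArg (ρ.α x) ?_)
    exact (e.symm_apply_apply _).symm

theorem FlowRepresentation.congr_α_apply {S X : Type*} [Semigroup S] [TopologicalSpace S]
    [TopologicalSpace X] [SemigroupAction S X] (ρ : FlowRepresentation S X V) (e : V ≃ₗᵢ[ℝ] W)
    (x : X) (v : V) : (ρ.congr e).α x (e v) = ρ.α x v :=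
  congrArg (ρ.α x) (e.symm_apply_apply v)

end Transfer

/-! ### The representation attached to a weakly almost periodic function -/

section WapRepresentation

variable (S : Type*) {X : Type*} [Semigroup S] [TopologicalSpace S]
  [TopologicalSpace X] [SemigroupAction S X] [IsSemitopFlow S X]

/-- Translation by `s` as a contraction of the space of bounded continuous functions. -/
noncomputable def flowTranslateCLM (s : S) : (X →ᵇ ℝ) →L[ℝ] (X →ᵇ ℝ) :=
  LinearMap.mkContinuous
    { toFun := fun f => flowTranslate S f s
      map_add' := fun _ _ => rfl
      map_smul' := fun _ _ => rfl } 1 fun f => by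
    rw [one_mul]
    exact (BoundedContinuousFunction.norm_le (norm_nonneg f)).2 fun x => f.norm_coe_le_norm (s • x)

theorem norm_flowTranslateCLM_le (s : S) : ‖flowTranslateCLM (X := X) S s‖ ≤ 1 :=
  LinearMap.mkContinuous_norm_le _ zero_le_one _

/-- The orbit of a function, together with the function. -/
def fullOrbit (f : X →ᵇ ℝ) : Set (X →ᵇ ℝ) := insert f (Set.range (flowTranslate S f))

theorem mapsTo_fullOrbit (f : X →ᵇ ℝ) (s : S) :
    Set.MapsTo (flowTranslateCLM S s) (fullOrbit S f) (fullOrbit S f) := by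
  rintro _ (rfl | ⟨t, rfl⟩)
  · exact Or.inr ⟨s, rfl⟩
  · refine Or.inr ⟨t * s, BoundedContinuousFunction.ext fun x => ?_⟩
    exact congrArg f (SemigroupAction.mul_smul t s x)

instance fact_isBounded_fullOrbit (f : X →ᵇ ℝ) : Fact (Bornology.IsBounded (fullOrbit S f)) := by
  refine ⟨isBounded_iff_forall_norm_le.2 ⟨‖f‖, ?_⟩⟩
  rintro _ (rfl | ⟨t, rfl⟩)
  · exact le_rfl
  · exact ((flowTranslateCLM S t).le_of_opNorm_le (norm_flowTranslateCLM_le S t) f).trans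
      (one_mul _).le

variable {S}

/-- Without an identity in `S`, `f` need not belong to its orbit; adjoining one point puts `f` in
the interpolation space without losing compactness. -/
theorem IsWapFunction.isCompact_closure_fullOrbit {f : X →ᵇ ℝ} (hf : IsWapFunction S f) :
    IsCompact (closure (toWeakSpace ℝ (X →ᵇ ℝ) '' fullOrbit S f)) := by
  refine ((isCompact_singleton (x := toWeakSpace ℝ (X →ᵇ ℝ) f)).union hf).closure_of_subset ?_
  rw [fullOrbit, Set.image_insert_eq, Set.insert_eq]
  exact Set.union_subset_union_right _ subset_closure

theorem IsWapFunction.isReflexiveSpace {f : X →ᵇ ℝ} (hf : IsWapFunction S f) :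
    IsReflexiveSpace (InterpSpace (fullOrbit S f)) :=
  isReflexiveSpace_interpSpace _ hf.isCompact_closure_fullOrbit

/-- The representation of the flow on the interpolation space of the orbit of a weakly almost
periodic function. -/
noncomputable def IsWapFunction.representation {f : X →ᵇ ℝ} (hf : IsWapFunction S f) :
    FlowRepresentation S X (InterpSpace (fullOrbit S f)) where
  h s := interpMap _ (flowTranslateCLM S s) (norm_flowTranslateCLM_le S s) (mapsTo_fullOrbit S f s)
  h_mul s t := ContinuousLinearMap.ext fun v => Subtype.ext <|
    BoundedContinuousFunction.ext fun x => congrArg v.1 (SemigroupAction.mul_smul s t x)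
  h_norm_le s := norm_interpMap_le _ _ _ _
  h_continuous := by
    -- Point evaluations separate the functions, and along them continuity in `s` is continuity of
    -- orbit maps.
    refine continuous_ofCLM_of_separating hf.isReflexiveSpace _ (fun s => norm_interpMap_le _ _ _ _)
      (Set.range fun x : X => (BoundedContinuousFunction.evalCLM ℝ x).comp
        (interpIncl (fullOrbit S f))) (fun v hv => ?_) ?_
    · exact Subtype.ext (BoundedContinuousFunction.ext fun x => hv _ ⟨x, rfl⟩)
    · rintro _ ⟨x, rfl⟩ v
      exact v.1.continuous.comp (IsSemitopFlow.continuous_orbitMap x)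
  -- The scaling brings evaluations into the unit ball; the added 1 keeps the factor invertible.
  α x := StrongDual.toWeakDual ((1 + ‖interpIncl (fullOrbit S f)‖)⁻¹ •
    (BoundedContinuousFunction.evalCLM ℝ x).comp (interpIncl (fullOrbit S f)))
  α_norm_le x := by
    set c := ‖interpIncl (fullOrbit S f)‖
    have hc : 0 ≤ c := norm_nonneg _
    refine ContinuousLinearMap.opNorm_le_bound _ zero_le_one fun v => ?_
    change ‖(1 + c)⁻¹ * (interpIncl (fullOrbit S f) v) x‖ ≤ 1 * ‖v‖
    rw [norm_mul, Real.norm_of_nonneg (by positivity), inv_mul_le_iff₀ (by positivity), one_mul]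
    calc _ ≤ ‖interpIncl (fullOrbit S f) v‖ := BoundedContinuousFunction.norm_coe_le_norm _ _
      _ ≤ c * ‖v‖ := ContinuousLinearMap.le_opNorm _ _
      _ ≤ (1 + c) * ‖v‖ := by gcongr; linarith
  α_continuous := WeakDual.continuous_of_continuous_eval fun v =>
    (v.1.continuous.const_smul (1 + ‖interpIncl (fullOrbit S f)‖)⁻¹ :)
  α_smul s x v := rfl

theorem IsWapFunction.representation_α_apply {f : X →ᵇ ℝ} (hf : IsWapFunction S f) (x : X)
    (v : InterpSpace (fullOrbit S f)) : hf.representation.α x v =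
      (1 + ‖interpIncl (fullOrbit S f)‖)⁻¹ * v.1 x := rfl

/-- A weakly almost periodic function is a matrix coefficient of a representation on a
reflexive space. -/
theorem IsWapFunction.exists_coefficient {f : X →ᵇ ℝ} (hf : IsWapFunction S f) :
    ∃ (v : InterpSpace (fullOrbit S f)) (c : ℝ), ∀ x, f x = c * hf.representation.α x v := by
  let v : InterpSpace (fullOrbit S f) :=
    ⟨f, mem_interpSubmodule_of_mem (K := fullOrbit S f) (Or.inl rfl)⟩
  refine ⟨v, 1 + ‖interpIncl (fullOrbit S f)‖, fun x => ?_⟩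
  rw [hf.representation_α_apply x v, mul_inv_cancel_left₀ (by positivity)]

end WapRepresentation

/-! ### Weak almost periodicity and approximability -/

/-- A point outside the closure of a set in a power of `ℝ` is uniformly separated from the set by
finitely many coordinates. -/
theorem exists_finset_le_abs_sub_of_notMem_closure {κ : Type*} {B : Set (κ → ℝ)} {y : κ → ℝ}
    (hy : y ∉ closure B) :
    ∃ (J : Finset κ) (ε : ℝ), 0 < ε ∧ ∀ b ∈ B, ∃ j ∈ J, ε ≤ |b j - y j| := by
  have h : (closure B)ᶜ ∈ 𝓝 y := isClosed_closure.isOpen_compl.mem_nhds hy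
  rw [nhds_pi, Filter.mem_pi] at h
  obtain ⟨I, hI, t, ht, hsub⟩ := h
  choose e he hball using fun j => Metric.mem_nhds_iff.1 (ht j)
  obtain ⟨ε, hε, hmin⟩ : ∃ ε > 0, ∀ j ∈ hI.toFinset, ε ≤ e j := by
    rcases hI.toFinset.eq_empty_or_nonempty with h0 | h0
    · exact ⟨1, one_pos, by simp [h0]⟩
    · obtain ⟨j, -, hj⟩ := Finset.exists_min_image _ e h0
      exact ⟨e j, he j, hj⟩
  refine ⟨hI.toFinset, ε, hε, fun b hb => ?_⟩
  by_contra! hcon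
  refine hsub (fun j hj => hball j ?_) (subset_closure hb)
  have hj' := hI.mem_toFinset.2 hj
  rw [Metric.mem_ball, Real.dist_eq]
  exact (hcon j hj').trans_le (hmin j hj')

theorem isInducing_weakDual_coe (V : Type*) [NormedAddCommGroup V] [NormedSpace ℝ V] :
    IsInducing fun (ψ : WeakDual ℝ V) (v : V) => ψ v := ⟨rfl⟩

theorem isInducing_sigma_uncurry {ι : Type*} (κ : ι → Type*) :
    IsInducing fun (y : ∀ i, κ i → ℝ) (j : Σ i, κ i) => y j.1 j.2 := by
  refine IsInducing.of_comp (g := fun (z : (Σ i, κ i) → ℝ) i k => z ⟨i, k⟩) ?_ ?_ IsInducing.id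
  · fun_prop
  · fun_prop

section

variable {S : Type*} {X : Type*} [Semigroup S] [TopologicalSpace S] [TopologicalSpace X]
  [SemigroupAction S X]

theorem IsReflApproximable.isWapFlow {S : Type v} {X : Type u} [Semigroup S]
    [TopologicalSpace S] [TopologicalSpace X] [SemigroupAction S X] [IsSemitopFlow S X]
    (h : IsReflApproximable.{u, v, w} S X) : IsWapFlow S X := by
  obtain ⟨ι, V, _, _, ρ, -, hV, hsep⟩ := h
  refine isWapFlow_of_reflexive_representations hV ρ fun x A hA hx => ?_
  obtain ⟨i, hi⟩ := hsep x A hA hx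
  rw [(isInducing_weakDual_coe (V i)).closure_eq_preimage_closure_image, Set.mem_preimage] at hi
  obtain ⟨J, ε, hε, hJ⟩ := exists_finset_le_abs_sub_of_notMem_closure hi
  refine ⟨J.map ⟨Sigma.mk i, sigma_mk_injective⟩, ε, hε, fun y hy => ?_⟩
  obtain ⟨v, hv, hvε⟩ := hJ _ (Set.mem_image_of_mem _ (Set.mem_image_of_mem _ hy))
  exact ⟨⟨i, v⟩, Finset.mem_map_of_mem _ hv, hvε⟩

/-- Each `f` is a weak-star continuous function of its `α`, so `α x` in the closure of `α '' A`
would put `f x` in the closure of `f '' A`. The lifts only adjust universes. -/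
theorem IsWapFlow.isReflApproximable {S : Type v} {X : Type u} [Semigroup S]
    [TopologicalSpace S] [TopologicalSpace X] [SemigroupAction S X] [IsSemitopFlow S X]
    (h : IsWapFlow S X) : IsReflApproximable.{u, v, max u w} S X := by
  let V : ULift.{w} {f : X →ᵇ ℝ // IsWapFunction S f} → Type (max u w) := fun f =>
    ULift.{w} (InterpSpace (fullOrbit S f.down.1))
  let e : ∀ f, InterpSpace (fullOrbit S f.down.1) ≃ₗᵢ[ℝ] V f := fun f =>
    (LinearIsometryEquiv.ulift ℝ (InterpSpace (fullOrbit S f.down.1))).symm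
  have hV : ∀ f, IsReflexiveSpace (V f) := fun f =>
    f.down.2.isReflexiveSpace.of_linearIsometryEquiv (e f)
  refine ⟨_, V, inferInstance, inferInstance, fun f => f.down.2.representation.congr (e f),
    fun f => (hV f).completeSpace, hV, fun x A hA hx => ?_⟩
  obtain ⟨f, hf⟩ := h x A hA hx
  refine ⟨⟨f⟩, fun hmem => hf ?_⟩
  obtain ⟨v, c, hc⟩ := f.2.exists_coefficient
  have hcont : Continuous fun ψ : WeakDual ℝ (V ⟨f⟩) => c * ψ (e ⟨f⟩ v) :=
    continuous_const.mul (WeakDual.eval_continuous _)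
  have hval : ∀ y, f.1 y = c * (f.2.representation.congr (e ⟨f⟩)).α y (e ⟨f⟩ v) := fun y => by
    rw [FlowRepresentation.congr_α_apply]
    exact hc y
  have := image_closure_subset_closure_image hcont ⟨_, hmem, rfl⟩
  rw [Set.image_image] at this
  simpa only [← hval] using this

/-! ### Subdirect products of Eberlein flows -/

namespace FlowRepresentation

variable {V : Type*} [NormedAddCommGroup V] [NormedSpace ℝ V] (ρ : FlowRepresentation S X V)

/-- The image of `X` in the dual of the representation space, with the dual action of `S`. -/
abbrev Range : Type _ := Set.range ρ.α

noncomputable instance : SemigroupAction S ρ.Range where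
  smul s ψ := ⟨StrongDual.toWeakDual ((WeakDual.toStrongDual ψ.1).comp (ρ.h s)), by
    obtain ⟨_, x, rfl⟩ := ψ
    exact ⟨s • x, ContinuousLinearMap.ext fun v => ρ.α_smul s x v⟩⟩
  mul_smul s t ψ := Subtype.ext <| ContinuousLinearMap.ext fun v =>
    congrArg ψ.1 (DFunLike.congr_fun (ρ.h_mul s t) v)

theorem range_smul_apply (s : S) (ψ : ρ.Range) (v : V) : (s • ψ).1 v = ψ.1 (ρ.h s v) := rfl

theorem smul_range_mk (s : S) (x : X) :
    s • (⟨ρ.α x, x, rfl⟩ : ρ.Range) = ⟨ρ.α (s • x), _, rfl⟩ :=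
  Subtype.ext <| ContinuousLinearMap.ext fun v => (ρ.α_smul s x v).symm

instance [IsSemitopFlow S X] : IsSemitopFlow S ρ.Range where
  continuous_translation s := Continuous.subtype_mk
    (WeakDual.continuous_of_continuous_eval fun v =>
      (WeakDual.eval_continuous (ρ.h s v)).comp continuous_subtype_val) _
  continuous_orbitMap ψ := Continuous.subtype_mk
    (WeakDual.continuous_of_continuous_eval fun v =>
      (ContinuousLinearMapWOT.continuous_dual_apply v (WeakDual.toStrongDual ψ.1)).comp
        ρ.h_continuous) _
  identity_smul e he := by
    rintro ⟨_, x, rfl⟩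
    rw [smul_range_mk]
    congr 2
    exact IsSemitopFlow.identity_smul e he x

/-- The tautological representation of the image of a representation. -/
noncomputable def rangeRepresentation : FlowRepresentation S ρ.Range V where
  h := ρ.h
  h_mul := ρ.h_mul
  h_norm_le := ρ.h_norm_le
  h_continuous := ρ.h_continuous
  α := Subtype.val
  α_norm_le := by
    rintro ⟨_, x, rfl⟩
    exact ρ.α_norm_le x
  α_continuous := continuous_subtype_val
  α_smul := range_smul_apply ρ

/-- Pull-back of a representation along a continuous equivariant map. -/
noncomputable def comap {Y : Type*} [TopologicalSpace Y] [SemigroupAction S Y]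
    (f : Y → X) (hf : Continuous f) (hfs : ∀ (s : S) (y : Y), f (s • y) = s • f y) :
    FlowRepresentation S Y V where
  h := ρ.h
  h_mul := ρ.h_mul
  h_norm_le := ρ.h_norm_le
  h_continuous := ρ.h_continuous
  α y := ρ.α (f y)
  α_norm_le y := ρ.α_norm_le (f y)
  α_continuous := ρ.α_continuous.comp hf
  α_smul s y v := by rw [hfs, ρ.α_smul]

end FlowRepresentation

end

/-- A family of continuous maps separating points and closed sets induces the topology. -/
theorem SeparatesPointsAndClosed.isInducing {X ι : Type*} [TopologicalSpace X] {Z : ι → Type*}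
    [∀ i, TopologicalSpace (Z i)] {f : ∀ i, X → Z i} (hf : SeparatesPointsAndClosed f)
    (hc : ∀ i, Continuous (f i)) : IsInducing fun x i => f i x := by
  rw [isInducing_iff_nhds]
  intro x
  refine le_antisymm (continuous_pi hc).continuousAt.le_comap fun U hU => ?_
  obtain ⟨i, hi⟩ := hf x (interior U)ᶜ isOpen_interior.isClosed_compl
    (by simpa using mem_interior_iff_mem_nhds.2 hU)
  refine ⟨{z | z i ∉ closure (f i '' (interior U)ᶜ)}, ?_, fun y hy => ?_⟩
  · exact (isClosed_closure.isOpen_compl.preimage (continuous_apply i)).mem_nhds hi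
  · by_contra hyU
    exact hy (subset_closure ⟨y, fun h => hyU (interior_subset h), rfl⟩)

/-- The factors are the images of the `α i`, Eberlein through their inclusions in the duals.
Separation makes the diagonal map inducing, and `T0` makes it injective. -/
theorem IsReflApproximable.isSubdirectProductOfEberlein {S : Type v} {X : Type u}
    [Semigroup S] [TopologicalSpace S] [TopologicalSpace X] [SemigroupAction S X]
    [IsSemitopFlow S X] [T0Space X] (h : IsReflApproximable.{u, v, w} S X) :
    IsSubdirectProductOfEberlein.{u, v, w} S X := by
  obtain ⟨ι, V, _, _, ρ, hc, hV, hsep⟩ := h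
  refine ⟨ι, fun i => (ρ i).Range, inferInstance, inferInstance, fun x i => ⟨(ρ i).α x, x, rfl⟩,
    inferInstance, fun i => ⟨V i, _, _, (ρ i).rangeRepresentation, hc i, hV i, .subtypeVal⟩,
    ?_, fun s x i => ((ρ i).smul_range_mk s x).symm⟩
  refine IsInducing.isEmbedding ?_
  have h1 := hsep.isInducing fun i => (ρ i).α_continuous
  refine IsInducing.of_comp ?_ (g := Pi.map fun i => Subtype.val) ?_ h1
  · exact continuous_pi fun i => (ρ i).α_continuous.subtype_mk _
  · exact continuous_pi fun i => continuous_subtype_val.comp (continuous_apply i)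

/-- A single factor may fail to separate a point from a closed set, but the coefficients of all
factors together induce the topology, so finitely many of them suffice. -/
theorem IsSubdirectProductOfEberlein.isWapFlow {S : Type v} {X : Type u}
    [Semigroup S] [TopologicalSpace S] [TopologicalSpace X] [SemigroupAction S X]
    [IsSemitopFlow S X] (h : IsSubdirectProductOfEberlein.{u, v, w} S X) : IsWapFlow S X := by
  obtain ⟨ι, Y, _, _, Φ, -, hE, hΦ, hΦs⟩ := h
  choose V _ _ ρ _ hV hρ using hE
  have hΦi : ∀ i, Continuous fun x => Φ x i := fun i => (continuous_apply i).comp hΦ.continuous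
  refine isWapFlow_of_reflexive_representations hV
    (fun i => (ρ i).comap (fun x => Φ x i) (hΦi i) fun s x => hΦs s x i) fun x A hA hx => ?_
  have hind : IsInducing fun (x : X) (j : Σ i, V i) => (ρ j.1).α (Φ x j.1) j.2 :=
    ((isInducing_sigma_uncurry V).comp
      (IsInducing.piMap fun i => (isInducing_weakDual_coe (V i)).comp (hρ i).isInducing)).comp
      hΦ.isInducing
  rw [← hA.closure_eq, hind.closure_eq_preimage_closure_image, Set.mem_preimage] at hx
  obtain ⟨J, ε, hε, hJ⟩ := exists_finset_le_abs_sub_of_notMem_closure hx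
  exact ⟨J, ε, hε, fun y hy => hJ _ (Set.mem_image_of_mem _ hy)⟩

theorem theorem4p5 (S : Type v) (X : Type u) [Semigroup S] [TopologicalSpace S]
    [SeparatelyContinuousMul S] [TopologicalSpace X] [SemigroupAction S X] [IsSemitopFlow S X] :
    (IsWapFlow S X ↔ IsReflApproximable.{u, v, max u w} S X) ∧
    (T0Space X →
      (IsReflApproximable.{u, v, max u w} S X ↔
        IsSubdirectProductOfEberlein.{u, v, max u w} S X)) :=
  ⟨⟨IsWapFlow.isReflApproximable.{u, v, w}, IsReflApproximable.isWapFlow⟩,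
    fun _ => ⟨IsReflApproximable.isSubdirectProductOfEberlein,
      fun h => h.isWapFlow.isReflApproximable.{u, v, w}⟩⟩
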